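/- **Theorem (Reduction of infinite-dimensional ellipsoids).** Let $\mathcal{C}^\infty_{\rm per}(\mathbf{R},\mathbf{C})$ be the space of smooth $1$-periodic functions, with its functional diffeology ($r\mapsto f_r$ is a plot iff $(r,x)\mapsto f_r(x)$ is smooth), carrying the $2$-form given on a plot $P:r\mapsto f_r$ by $$\omega(P)_r(\delta r,\delta' r)=\frac{1}{2i\pi}\int_0^1\left\{\overline{\frac{\partial f_r(x)}{\partial r}(\delta r)}\,\frac{\partial f_r(x)}{\partial r}(\delta' r)-\overline{\frac{\partial f_r(x)}{\partial r}(\delta' r)}\,\frac{\partial f_r(x)}{\partial r}(\delta r)\right\}dx .$$ Let $\mathcal{E}$ be the space of rapidly decreasing families $Z=(Z_n)_{n\in\mathbf{Z}}$ of complex numbers, where a parametrization $r\mapsto (Z_n(r))_{n}$ is a plot iff every $Z_n$ is smooth and, for all $k,p\in\mathbf{N}$, $|n|^p\,\|\partial^kZ_n(r)/\partial r^k\|\to 0$ as $|n|\to\infty$, locally uniformly in $r$. Transport $\omega$ to $\mathcal{E}$ by Fourier synthesis $(Z_n)_n\mapsto \big(x\mapsto\sum_n Z_ne^{2i\pi nx}\big)$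 and still write $\omega$ for the resulting $2$-form. Let $\alpha=(\alpha_n)_{n\in\mathbf{Z}}$ be real numbers, linearly independent over $\mathbf{Q}$, with $0<\alpha_n<1$. Let $t\in\mathbf{R}$ act on $\mathcal{E}$ by $(Z_n)_n\mapsto(e^{2i\pi\alpha_nt}Z_n)_n$. Put $S_\alpha^\infty=\{Z\in\mathcal{E}\mid\sum_n\alpha_n|Z_n|^2=1\}$ with the subset diffeology, and $P_\alpha^\infty=S_\alpha^\infty/\mathbf{R}$ with the quotient diffeology and projection $\mathrm{class}:S_\alpha^\infty\to P_\alpha^\infty$. Then: 1. For each $n$, the set $S_n^1=\{Z\in S_\alpha^\infty\mid Z_m=0\text{ for all }m\neq n\}$ is a single orbit of $\mathbf{R}$, all of whose points have stabilizer $\frac{1}{\alpha_n}\mathbf{Z}$, and $Z\mapsto Z_n$ is a diffeomorphism from $S_n^1$ onto the circle of radius $1/\sqrt{\alpha_n}$ centred at $0$ in $\mathbf{C}$. The sets $S_n^1$ are pairwise disjoint, and the action is free on $S_\alpha^\infty\setminus\bigcup_nS_n^1$. 2. The form $\omega$ on $\mathcal{E}$ is closed, and its restriction to $S_\alpha^\infty$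 descends to the quotient: there is a closed $2$-form $\varpi$ on $P_\alpha^\infty$ (a parasymplectic form) such that $\mathrm{class}^*(\varpi)=\omega\restriction S_\alpha^\infty$. Here a $k$-form on a diffeological space assigns to each plot $P$ a smooth $k$-form on the domain of $P$, compatibly with smooth reparametrizations; it is closed if all these forms are closed, and the pullback is $f^*(\beta)(P)=\beta(f\circ P)$. -/

import Mathlib

namespace EllipsoidReduction

open Filter Topology Set Diffeology
open scoped ContDiff


/-- The Euclidean space `ℝⁿ`. -/
abbrev Eu (n : ℕ) : Type := EuclideanSpace ℝ (Fin n)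

theorem exists_retract {n : ℕ} (x : Eu n) {u : Set (Eu n)} (hu : u ∈ 𝓝 x) :
    ∃ ρ : Eu n → Eu n, ContDiff ℝ ∞ ρ ∧ (∀ y, ρ y ∈ u) ∧ ρ =ᶠ[𝓝 x] id ∧
      ∃ R : ℝ, ∀ y, R < dist y x → ρ y = x := by
  obtain ⟨ε, hε, hεu⟩ := Metric.mem_nhds_iff.1 hu
  let b : ContDiffBump x := ⟨ε / 2, ε, by positivity, by linarith⟩
  refine ⟨fun y => x + b y • (y - x), ?_, fun y => ?_, ?_, ε, fun y hy => ?_⟩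
  · have : ContDiff ℝ ∞ b := b.contDiff
    fun_prop
  · by_cases hy : y ∈ Metric.ball x ε
    · apply hεu
      rw [mem_ball_iff_norm] at hy ⊢
      rw [add_sub_cancel_left, norm_smul, Real.norm_of_nonneg b.nonneg]
      calc b y * ‖y - x‖ ≤ 1 * ‖y - x‖ := by gcongr; exact b.le_one
        _ < ε := by simpa using hy
    · have : b y = 0 := b.zero_of_le_dist (by simpa using hy)
      simp only [this, zero_smul, add_zero]
      exact mem_of_mem_nhds hu
  · filter_upwards [b.eventuallyEq_one] with y hy
    simp [hy]
  · have : b y = 0 := b.zero_of_le_dist hy.le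
    simp [this]

/-- A diffeology given by a class of parametrizations that contains the constants, is stable under
smooth reparametrization, and is local. -/
abbrev diffeologyOfGerms {X : Type*} (P : ∀ n : ℕ, (Eu n → X) → Prop)
    (const : ∀ n x, P n (fun _ => x))
    (reparam : ∀ m n (p : Eu m → X) (f : Eu n → Eu m), P m p → ContDiff ℝ ∞ f → P n (p ∘ f))
    (loc : ∀ n (p : Eu n → X), (∀ x, ∃ q, P n q ∧ p =ᶠ[𝓝 x] q) → P n p) :
    DiffeologicalSpace X where
  plots n := {p | P n p}
  constant_plots x := const _ x
  plot_reparam hp hf := reparam _ _ _ _ hp hf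
  locality {n p} hp := by
    refine loc n p fun x => ?_
    obtain ⟨u, huo, hxu, h⟩ := hp x
    obtain ⟨ρ, hρ, hρu, hρx, -⟩ := exists_retract x (huo.mem_nhds hxu)
    refine ⟨p ∘ ρ, h hρu hρ, ?_⟩
    filter_upwards [hρx] with y hy
    simp [hy]

theorem isPlot_of_germs {X : Type*} [DiffeologicalSpace X] {n : ℕ} {p : Eu n → X}
    (h : ∀ x, ∃ q : Eu n → X, IsPlot q ∧ p =ᶠ[𝓝 x] q) : IsPlot p := by
  refine DiffeologicalSpace.locality fun x => ?_
  obtain ⟨q, hq, hpq⟩ := h x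
  obtain ⟨u, hu, huo, hxu⟩ := mem_nhds_iff.1 hpq
  refine ⟨u, huo, hxu, fun {m f} hf hfs => ?_⟩
  have : p ∘ f = q ∘ f := funext fun y => hu (hf y)
  rw [this]
  exact isPlot_reparam hq hfs

/-- The subset diffeology: plots of a subset are the plots of the ambient space valued in it. -/
instance subsetDiffeology {X : Type*} [DiffeologicalSpace X] (A : Set X) :
    DiffeologicalSpace A :=
  diffeologyOfGerms (fun _ p => IsPlot (Subtype.val ∘ p))
    (fun _ _ => isPlot_const)
    (fun _ _ _ _ hp hf => isPlot_reparam hp hf)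
    (fun _ _ h => isPlot_of_germs fun x =>
      let ⟨q, hq, hpq⟩ := h x
      ⟨Subtype.val ∘ q, hq, hpq.fun_comp Subtype.val⟩)

/-- The quotient diffeology: plots of a quotient are the parametrizations that lift locally to
plots of the total space. -/
instance quotientDiffeology {X : Type*} [DiffeologicalSpace X] (s : Setoid X) :
    DiffeologicalSpace (Quotient s) :=
  diffeologyOfGerms
    (fun n p => ∀ x, ∃ q : Eu n → X, IsPlot q ∧ p =ᶠ[𝓝 x] fun y => Quotient.mk s (q y))
    (fun _ c x => by
      obtain ⟨z, rfl⟩ := Quotient.exists_rep c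
      exact ⟨fun _ => z, isPlot_const, .rfl⟩)
    (fun _ _ p f hp hf x => by
      obtain ⟨q, hq, hpq⟩ := hp (f x)
      exact ⟨q ∘ f, isPlot_reparam hq hf, hf.continuous.continuousAt.eventually hpq⟩)
    (fun _ p h x => by
      obtain ⟨q, hq, hpq⟩ := h x
      obtain ⟨q', hq', h'⟩ := hq x
      exact ⟨q', hq', hpq.trans h'⟩)

theorem dSmooth_val {X : Type*} [DiffeologicalSpace X] (A : Set X) :
    DSmooth (Subtype.val : A → X) := fun _ _ hp => hp

theorem dSmooth_mk {X : Type*} [DiffeologicalSpace X] (s : Setoid X) :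
    DSmooth (Quotient.mk s) := fun _ p hp _ => ⟨p, hp, .rfl⟩

/-- A differential `k`-form on a diffeological space: a smooth `k`-form on the domain of each plot,
compatible with smooth reparametrizations. -/
@[ext]
structure DiffForm (X : Type*) [DiffeologicalSpace X] (k : ℕ) where
  /-- The value of the form on a plot. -/
  eval : ∀ {n : ℕ} (p : Eu n → X), IsPlot p → Eu n → Eu n [⋀^Fin k]→L[ℝ] ℝ
  contDiff_eval : ∀ {n : ℕ} (p : Eu n → X) (hp : IsPlot p), ContDiff ℝ ∞ (eval p hp)
  eval_comp : ∀ {m n : ℕ} (p : Eu m → X) (hp : IsPlot p) (f : Eu n → Eu m)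
    (hf : ContDiff ℝ ∞ f) (r : Eu n),
    eval (p ∘ f) (isPlot_reparam hp hf) r =
      (eval p hp (f r)).compContinuousLinearMap (fderiv ℝ f r)

namespace DiffForm

variable {X Y : Type*} [DiffeologicalSpace X] [DiffeologicalSpace Y] {k : ℕ}

/-- The form is closed: `d(β(P)) = 0` for every plot `P`. -/
def IsClosed (β : DiffForm X k) : Prop :=
  ∀ (n : ℕ) (p : Eu n → X) (hp : IsPlot p), extDeriv (β.eval p hp) = 0

/-- The pullback `f^*β : P ↦ β(f ∘ P)` of a form by a smooth map. -/
def pullback (f : X → Y) (hf : DSmooth f) (β : DiffForm Y k) : DiffForm X k where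
  eval p hp := β.eval (f ∘ p) (hf _ _ hp)
  contDiff_eval _ _ := β.contDiff_eval _ _
  eval_comp p hp g hg r := β.eval_comp (f ∘ p) (hf _ _ hp) g hg r

end DiffForm

/-! ### The space of Fourier coefficients -/

/-- The space of rapidly decreasing families of complex numbers indexed by `ℤ`. -/
@[ext]
structure FourierSpace where
  /-- The underlying family. -/
  coeff : ℤ → ℂ
  rapid : ∀ q : ℕ, Tendsto (fun m : ℤ => |(m : ℝ)| ^ q * ‖coeff m‖) cofinite (𝓝 0)

/-- A family of functions on `ℝⁿ` is smooth, and its successive derivatives are (locally)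
uniformly rapidly decreasing. -/
def IsRapidFamily {n : ℕ} (c : ℤ → Eu n → ℂ) : Prop :=
  (∀ m, ContDiff ℝ ∞ (c m)) ∧ ∀ k q : ℕ, TendstoLocallyUniformly
    (fun (m : ℤ) r => |(m : ℝ)| ^ q * ‖iteratedFDeriv ℝ k (c m) r‖) (fun _ => 0) cofinite

theorem tendsto_inv_one_add_abs :
    Tendsto (fun m : ℤ => (1 + |(m : ℝ)|)⁻¹) cofinite (𝓝 0) := by
  refine tendsto_inv_atTop_zero.comp (tendsto_atTop_add_const_left _ _ ?_)
  rw [Int.cofinite_eq]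
  exact (tendsto_abs_atBot_atTop.comp (tendsto_intCast_atBot_iff.2 tendsto_id)).sup
    (tendsto_abs_atTop_atTop.comp tendsto_intCast_atTop_atTop)

theorem one_add_pow_le {x : ℝ} (hx : 1 ≤ x) (q : ℕ) : (1 + x) ^ q ≤ 2 ^ q * x ^ q := by
  rw [← mul_pow]
  gcongr
  linarith

theorem abs_intCast_ge_one {m : ℤ} (hm : m ≠ 0) : (1 : ℝ) ≤ |(m : ℝ)| := by
  exact_mod_cast Int.one_le_abs hm

theorem isRapidFamily_iff {n : ℕ} {c : ℤ → Eu n → ℂ} :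
    IsRapidFamily c ↔ (∀ m, ContDiff ℝ ∞ (c m)) ∧ ∀ (k q : ℕ) (r : Eu n), ∃ C : ℝ,
      ∀ᶠ s in 𝓝 r, ∀ m : ℤ, (1 + |(m : ℝ)|) ^ q * ‖iteratedFDeriv ℝ k (c m) s‖ ≤ C := by
  refine and_congr_right fun hc => ⟨fun h k q r => ?_, fun h k q => ?_⟩
  · obtain ⟨t, ht, h1⟩ := Metric.tendstoLocallyUniformly_iff.1 (h k q) 1 one_pos r
    set T : Set ℤ := {m | ¬ ∀ s ∈ t, dist (0 : ℝ)
      (|(m : ℝ)| ^ q * ‖iteratedFDeriv ℝ k (c m) s‖) < 1} ∪ {0} with hT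
    have hTf : T.Finite := (eventually_cofinite.1 h1).union (finite_singleton 0)
    have h2 : ∀ m : ℤ, ∃ C, ∀ᶠ s in 𝓝 r,
        (1 + |(m : ℝ)|) ^ q * ‖iteratedFDeriv ℝ k (c m) s‖ ≤ C := fun m => by
      have : Continuous fun s => (1 + |(m : ℝ)|) ^ q * ‖iteratedFDeriv ℝ k (c m) s‖ :=
        continuous_const.mul ((hc m).continuous_iteratedFDeriv (by exact_mod_cast le_top)).norm
      exact ⟨_, (this.continuousAt.eventually_lt continuousAt_const
        (lt_add_one _)).mono fun _ h => h.le⟩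
    choose C hC using h2
    obtain ⟨M, hM⟩ := (hTf.image C).bddAbove
    refine ⟨max M (2 ^ q), ?_⟩
    filter_upwards [ht, (eventually_all_finite hTf).2 fun m _ => hC m] with s hs hs' m
    by_cases hm : m ∈ T
    · exact (hs' m hm).trans ((hM (mem_image_of_mem C hm)).trans (le_max_left _ _))
    · simp only [hT, mem_union, mem_ofPred_eq, mem_singleton_iff, not_or, not_not] at hm
      have h3 := hm.1 s hs
      rw [dist_zero_left, Real.norm_of_nonneg (by positivity)] at h3
      refine le_trans ?_ (le_max_right _ _)
      calc (1 + |(m : ℝ)|) ^ q * ‖iteratedFDeriv ℝ k (c m) s‖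
          ≤ (2 ^ q * |(m : ℝ)| ^ q) * ‖iteratedFDeriv ℝ k (c m) s‖ := by
            gcongr; exact one_add_pow_le (abs_intCast_ge_one hm.2) q
        _ = 2 ^ q * (|(m : ℝ)| ^ q * ‖iteratedFDeriv ℝ k (c m) s‖) := by ring
        _ ≤ 2 ^ q * 1 := by gcongr
        _ = 2 ^ q := mul_one _
  · rw [Metric.tendstoLocallyUniformly_iff]
    intro ε hε r
    obtain ⟨C, hC⟩ := h k (q + 1) r
    refine ⟨_, hC, ?_⟩
    have h1 := (tendsto_inv_one_add_abs.mul_const C)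
    rw [zero_mul] at h1
    filter_upwards [h1.eventually (gt_mem_nhds hε)] with m hm s hs
    rw [dist_zero_left, Real.norm_of_nonneg (by positivity)]
    refine lt_of_le_of_lt ?_ hm
    have hs' := hs m
    rw [inv_mul_eq_div, le_div_iff₀ (by positivity)]
    refine le_trans ?_ hs'
    calc |(m : ℝ)| ^ q * ‖iteratedFDeriv ℝ k (c m) s‖ * (1 + |(m : ℝ)|)
        ≤ (1 + |(m : ℝ)|) ^ q * ‖iteratedFDeriv ℝ k (c m) s‖ * (1 + |(m : ℝ)|) := by
          gcongr; linarith
      _ = _ := by ring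

theorem FourierSpace.exists_bound (Z : FourierSpace) (q : ℕ) :
    ∃ C : ℝ, ∀ m : ℤ, (1 + |(m : ℝ)|) ^ q * ‖Z.coeff m‖ ≤ C := by
  obtain ⟨C, hC⟩ := (Z.rapid q).bddAbove_range_of_cofinite
  refine ⟨max (2 ^ q * C) ‖Z.coeff 0‖, fun m => ?_⟩
  rcases eq_or_ne m 0 with rfl | hm
  · simp
  · refine le_trans ?_ (le_max_left _ _)
    calc (1 + |(m : ℝ)|) ^ q * ‖Z.coeff m‖ ≤ (2 ^ q * |(m : ℝ)| ^ q) * ‖Z.coeff m‖ := by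
          gcongr; exact one_add_pow_le (abs_intCast_ge_one hm) q
      _ = 2 ^ q * (|(m : ℝ)| ^ q * ‖Z.coeff m‖) := by ring
      _ ≤ 2 ^ q * C := by gcongr; exact hC (mem_range_self m)

theorem isRapidFamily_const (n : ℕ) (Z : FourierSpace) :
    IsRapidFamily (fun m (_ : Eu n) => Z.coeff m) := by
  refine isRapidFamily_iff.2 ⟨fun m => contDiff_const, fun k q r => ?_⟩
  obtain ⟨C, hC⟩ := Z.exists_bound q
  refine ⟨C, Eventually.of_forall fun s m => ?_⟩
  have hC0 := le_trans (by positivity) (hC m)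
  rcases Nat.eq_zero_or_pos k with rfl | hk
  · simpa using hC m
  · rw [iteratedFDeriv_const_of_ne hk.ne']
    simpa using hC0

theorem IsRapidFamily.comp {a b : ℕ} {c : ℤ → Eu b → ℂ} (hc : IsRapidFamily c)
    {f : Eu a → Eu b} (hf : ContDiff ℝ ∞ f) : IsRapidFamily (fun m r => c m (f r)) := by
  rw [isRapidFamily_iff] at hc ⊢
  refine ⟨fun m => (hc.1 m).comp hf, fun k q r => ?_⟩
  choose C hC using fun i => hc.2 i q (f r)
  have h1 : ∀ i, ∃ D, ∀ᶠ s in 𝓝 r, ‖iteratedFDeriv ℝ i f s‖ ≤ D := fun i => by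
    have : Continuous fun s => ‖iteratedFDeriv ℝ i f s‖ :=
      (hf.continuous_iteratedFDeriv (by exact_mod_cast le_top)).norm
    exact ⟨_, (this.continuousAt.eventually_lt continuousAt_const
      (lt_add_one _)).mono fun _ h => h.le⟩
  choose D hD using h1
  obtain ⟨M, hM⟩ := ((Set.finite_Iic k).image C).bddAbove
  obtain ⟨N, hN⟩ := ((Set.finite_Iic k).image D).bddAbove
  have e1 : ∀ᶠ s in 𝓝 r, ∀ i ∈ Set.Iic k, ∀ m : ℤ,
      (1 + |(m : ℝ)|) ^ q * ‖iteratedFDeriv ℝ i (c m) (f s)‖ ≤ C i :=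
    (eventually_all_finite (Set.finite_Iic k)).2 fun i _ =>
      hf.continuous.continuousAt.eventually (hC i)
  have e2 : ∀ᶠ s in 𝓝 r, ∀ i ∈ Set.Iic k, ‖iteratedFDeriv ℝ i f s‖ ≤ D i :=
    (eventually_all_finite (Set.finite_Iic k)).2 fun i _ => hD i
  refine ⟨k.factorial * M * (max N 1) ^ k, ?_⟩
  filter_upwards [e1, e2] with s h1 h2 m
  have hpos : 0 < (1 + |(m : ℝ)|) ^ q := by positivity
  have := norm_iteratedFDeriv_comp_le (n := k) (hc.1 m) hf (by exact_mod_cast le_top) s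
    (C := M / (1 + |(m : ℝ)|) ^ q) (D := max N 1)
    (fun i hi => by
      rw [le_div_iff₀ hpos, mul_comm]
      exact (h1 i hi m).trans (hM (mem_image_of_mem C hi)))
    (fun i hi1 hi => by
      refine (h2 i hi).trans ((hN (mem_image_of_mem D hi)).trans ((le_max_left N 1).trans ?_))
      exact le_self_pow₀ (le_max_right _ _) (by lia))
  calc _ ≤ (1 + |(m : ℝ)|) ^ q *
        (k.factorial * (M / (1 + |(m : ℝ)|) ^ q) * (max N 1) ^ k) :=
        mul_le_mul_of_nonneg_left this hpos.le
    _ = _ := by field_simp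

theorem isRapidFamily_of_germs {n : ℕ} {c : ℤ → Eu n → ℂ}
    (h : ∀ x, ∃ d : ℤ → Eu n → ℂ, IsRapidFamily d ∧ ∀ᶠ y in 𝓝 x, ∀ m, c m y = d m y) :
    IsRapidFamily c := by
  rw [isRapidFamily_iff]
  refine ⟨fun m => contDiff_iff_contDiffAt.2 fun x => ?_, fun k q r => ?_⟩
  · obtain ⟨d, hd, hcd⟩ := h x
    exact (hd.1 m).contDiffAt.congr_of_eventuallyEq (hcd.mono fun y hy => hy m)
  · obtain ⟨d, hd, hcd⟩ := h r
    obtain ⟨C, hC⟩ := (isRapidFamily_iff.1 hd).2 k q r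
    refine ⟨C, ?_⟩
    filter_upwards [hC, hcd.eventually_nhds] with s hs hs' m
    have : c m =ᶠ[𝓝 s] d m := hs'.mono fun y hy => hy m
    rw [(this.iteratedFDeriv ℝ k).eq_of_nhds]
    exact hs m

/-- The diffeology of the space of Fourier coefficients: a parametrization is a plot if its
components are smooth and their successive derivatives are uniformly rapidly decreasing. -/
instance fourierDiffeology : DiffeologicalSpace FourierSpace :=
  diffeologyOfGerms (fun _ p => IsRapidFamily fun m r => (p r).coeff m)
    (fun n Z => isRapidFamily_const n Z)
    (fun _ _ _ _ hp hf => hp.comp hf)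
    (fun _ _ h => isRapidFamily_of_germs fun x =>
      let ⟨q, hq, hpq⟩ := h x
      ⟨_, hq, hpq.mono fun y hy m => by rw [hy]⟩)

/-! ### Smooth periodic functions -/

/-- The space of smooth `1`-periodic functions from `ℝ` to `ℂ`. -/
@[ext]
structure PeriodicSmooth where
  /-- The underlying function. -/
  toFun : ℝ → ℂ
  contDiff : ContDiff ℝ ∞ toFun
  periodic : Function.Periodic toFun 1

/-- The functional diffeology: `r ↦ f_r` is a plot if `(r, x) ↦ f_r(x)` is smooth. -/
instance functionalDiffeology : DiffeologicalSpace PeriodicSmooth :=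
  diffeologyOfGerms (fun n p => ContDiff ℝ ∞ fun y : Eu n × ℝ => (p y.1).toFun y.2)
    (fun n f => f.contDiff.comp contDiff_snd)
    (fun _ _ p f hp hf => hp.comp ((hf.comp contDiff_fst).prodMk contDiff_snd))
    (fun _ p h => contDiff_iff_contDiffAt.2 fun y => by
      obtain ⟨q, hq, hpq⟩ := h y.1
      refine hq.contDiffAt.congr_of_eventuallyEq ?_
      filter_upwards [continuous_fst.continuousAt.eventually hpq] with z hz
      rw [hz])

theorem summable_inv_one_add_sq :
    Summable fun m : ℤ => ((1 + |(m : ℝ)|) ^ 2)⁻¹ := by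
  have h := (Real.summable_one_div_int_add_rpow (1 / 2) 2).2 (by norm_num)
  refine h.of_nonneg_of_le (fun m => by positivity) fun m => ?_
  rw [one_div, Real.rpow_ofNat]
  have h0 : (m : ℝ) + 1 / 2 ≠ 0 := by
    intro h
    have : ((2 * m + 1 : ℤ) : ℝ) = 0 := by push_cast; linarith
    have : 2 * m + 1 = 0 := by exact_mod_cast this
    lia
  have h1 : 0 < |(m : ℝ) + 1 / 2| := abs_pos.2 h0
  gcongr
  calc |(m : ℝ) + 1 / 2| ≤ |(m : ℝ)| + |(1 : ℝ) / 2| := abs_add_le _ _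
    _ ≤ 1 + |(m : ℝ)| := by rw [abs_of_pos (by norm_num : (0 : ℝ) < 1 / 2)]; linarith

/-- The character `x ↦ e^{2πimx}`. -/
noncomputable def character (m : ℤ) (x : ℝ) : ℂ :=
  Complex.exp (2 * Real.pi * Complex.I * m * x)

theorem contDiff_character (m : ℤ) : ContDiff ℝ ∞ (character m) := by
  unfold character
  have : ContDiff ℝ ∞ fun x : ℝ => (x : ℂ) := Complex.ofRealCLM.contDiff
  exact (contDiff_const.mul this).cexp

theorem norm_iteratedFDeriv_character (k : ℕ) (m : ℤ) (x : ℝ) :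
    ‖iteratedFDeriv ℝ k (character m) x‖ = (2 * Real.pi * |(m : ℝ)|) ^ k := by
  have h : ∀ k : ℕ, iteratedDeriv k (character m) =
      fun x => (2 * Real.pi * Complex.I * m) ^ k * character m x := by
    intro k
    induction k with
    | zero => simp
    | succ k ih =>
      rw [iteratedDeriv_succ, ih]
      funext y
      have h1 : HasDerivAt (fun y : ℝ => 2 * Real.pi * Complex.I * m * (y : ℂ))
          (2 * Real.pi * Complex.I * m * 1) y :=
        (Complex.ofRealCLM.hasDerivAt (x := y)).const_mul _
      have h2 := (h1.cexp.const_mul ((2 * Real.pi * Complex.I * m) ^ k)).deriv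
      simp only [character] at h2 ⊢
      rw [h2]
      ring
  rw [norm_iteratedFDeriv_eq_norm_iteratedDeriv, h]
  have : ‖character m x‖ = 1 := by
    rw [character, show 2 * Real.pi * Complex.I * m * x
      = ((2 * Real.pi * m * x : ℝ) : ℂ) * Complex.I by push_cast; ring]
    exact Complex.norm_exp_ofReal_mul_I _
  rw [norm_mul, this, norm_pow, mul_one]
  simp [abs_of_pos Real.pi_pos]

theorem norm_iteratedFDeriv_comp_proj_le {F G V : Type} [NormedAddCommGroup F] [NormedSpace ℝ F]
    [NormedAddCommGroup G] [NormedSpace ℝ G] [NormedAddCommGroup V] [NormedSpace ℝ V]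
    {g : F → V} (hg : ContDiff ℝ ∞ g) (L : G →L[ℝ] F) (hL : ‖L‖ ≤ 1) (k : ℕ) (y : G) :
    ‖iteratedFDeriv ℝ k (fun z => g (L z)) y‖ ≤ ‖iteratedFDeriv ℝ k g (L y)‖ := by
  have h := L.iteratedFDeriv_comp_right hg y (i := k) (by exact_mod_cast le_top)
  have h' : iteratedFDeriv ℝ k (fun z => g (L z)) y = _ := h
  rw [h']
  refine (ContinuousMultilinearMap.norm_compContinuousLinearMap_le _ _).trans ?_
  refine mul_le_of_le_one_right (norm_nonneg _) ?_
  exact Finset.prod_le_one (fun _ _ => norm_nonneg _) fun _ _ => hL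

theorem contDiff_fourierSeries {F : Type} [NormedAddCommGroup F] [NormedSpace ℝ F]
    {c : ℤ → F → ℂ} (hc : ∀ m, ContDiff ℝ ∞ (c m))
    (hb : ∀ k q : ℕ, ∃ C : ℝ, ∀ (s : F) (m : ℤ), (1 + |(m : ℝ)|) ^ q * ‖iteratedFDeriv ℝ k (c m) s‖ ≤ C) :
    ContDiff ℝ ∞ fun y : F × ℝ => ∑' m : ℤ, c m y.1 * character m y.2 := by
  choose C hC using hb
  have h1 : ∀ m, ContDiff ℝ ∞ fun y : F × ℝ => c m y.1 := fun m => (hc m).comp contDiff_fst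
  have h2 : ∀ m, ContDiff ℝ ∞ fun y : F × ℝ => character m y.2 :=
    fun m => (contDiff_character m).comp contDiff_snd
  refine contDiff_tsum (N := ⊤) (v := fun k (m : ℤ) => (∑ i ∈ Finset.range (k + 1),
    (k.choose i : ℝ) * C i (k + 2) * (2 * Real.pi) ^ (k - i)) * ((1 + |(m : ℝ)|) ^ 2)⁻¹)
    (fun m => (h1 m).mul (h2 m)) (fun k _ => summable_inv_one_add_sq.mul_left _) ?_
  intro k m y _
  refine (norm_iteratedFDeriv_mul_le (h1 m) (h2 m) y (by exact_mod_cast le_top)).trans ?_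
  rw [Finset.sum_mul]
  refine Finset.sum_le_sum fun i hi => ?_
  have hik : i ≤ k := by simpa [Nat.lt_succ_iff] using hi
  have e1 : ‖iteratedFDeriv ℝ i (fun y : F × ℝ => c m y.1) y‖ ≤
      C i (k + 2) / (1 + |(m : ℝ)|) ^ (k + 2) := by
    refine (norm_iteratedFDeriv_comp_proj_le (hc m) (ContinuousLinearMap.fst ℝ F ℝ)
      (ContinuousLinearMap.norm_fst_le ..) i y).trans ?_
    rw [le_div_iff₀ (by positivity), mul_comm]
    exact hC i (k + 2) _ m
  have e2 : ‖iteratedFDeriv ℝ (k - i) (fun y : F × ℝ => character m y.2) y‖ ≤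
      (2 * Real.pi) ^ (k - i) * (1 + |(m : ℝ)|) ^ k := by
    refine (norm_iteratedFDeriv_comp_proj_le (contDiff_character m)
      (ContinuousLinearMap.snd ℝ F ℝ) (ContinuousLinearMap.norm_snd_le ..) _ y).trans ?_
    rw [norm_iteratedFDeriv_character, mul_pow]
    gcongr
    calc |(m : ℝ)| ^ (k - i) ≤ (1 + |(m : ℝ)|) ^ (k - i) := by gcongr; linarith
      _ ≤ (1 + |(m : ℝ)|) ^ k :=
        pow_le_pow_right₀ (by linarith [abs_nonneg (m : ℝ)]) (Nat.sub_le _ _)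
  have hC0 : 0 ≤ C i (k + 2) := le_trans (by positivity) (hC i (k + 2) y.1 m)
  calc _ ≤ (k.choose i : ℝ) * (C i (k + 2) / (1 + |(m : ℝ)|) ^ (k + 2)) *
        ((2 * Real.pi) ^ (k - i) * (1 + |(m : ℝ)|) ^ k) := by gcongr
    _ = _ := by
      rw [pow_add]
      field_simp

/-- The smooth periodic function with prescribed Fourier coefficients,
`x ↦ ∑ Z_m e^{2πimx}`: the inverse of the map sending a function to its Fourier coefficients. -/
noncomputable def fourierSynthesis (Z : FourierSpace) : PeriodicSmooth where
  toFun x := ∑' m, Z.coeff m * character m x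
  contDiff := by
    have h := contDiff_fourierSeries (F := ℝ) (c := fun m _ => Z.coeff m)
      (fun m => contDiff_const) (fun k q => by
        obtain ⟨C, hC⟩ := Z.exists_bound q
        refine ⟨C, fun s m => ?_⟩
        have hC0 := le_trans (by positivity) (hC m)
        rcases Nat.eq_zero_or_pos k with rfl | hk
        · simpa using hC m
        · rw [iteratedFDeriv_const_of_ne hk.ne']
          simpa using hC0)
    exact h.comp (contDiff_id.prodMk contDiff_id)
  periodic x := by
    refine tsum_congr fun m => ?_
    congr 1
    simp only [character]
    rw [show 2 * (Real.pi : ℂ) * Complex.I * m * ((x + 1 : ℝ) : ℂ) =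
      2 * Real.pi * Complex.I * m * x + m * (2 * Real.pi * Complex.I) by push_cast; ring,
      Complex.exp_add, Complex.exp_int_mul_two_pi_mul_I, mul_one]

theorem dSmooth_fourierSynthesis : DSmooth fourierSynthesis := by
  intro n p hp
  change ContDiff ℝ ∞ fun y : Eu n × ℝ => (fourierSynthesis (p y.1)).toFun y.2
  refine contDiff_iff_contDiffAt.2 fun y => ?_
  obtain ⟨ρ, hρ, -, hρy, R, hR⟩ := exists_retract y.1 univ_mem
  have hp' : IsRapidFamily fun m r => (p r).coeff m := hp
  have hq := isRapidFamily_iff.1 (hp'.comp hρ)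
  have key := contDiff_fourierSeries hq.1 (fun k q => by
    choose C hC using hq.2 k q
    obtain ⟨t, -, ht⟩ := (isCompact_closedBall y.1 R).elim_nhds_subcover _ (fun x _ => hC x)
    obtain ⟨M, hM⟩ := (t.finite_toSet.image C).bddAbove
    obtain ⟨K, hK⟩ := (p y.1).exists_bound q
    refine ⟨max M K, fun s m => ?_⟩
    by_cases hs : s ∈ Metric.closedBall y.1 R
    · obtain ⟨x, hx, hsx⟩ := mem_iUnion₂.1 (ht hs)
      exact (hsx m).trans ((hM (mem_image_of_mem C hx)).trans (le_max_left _ _))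
    · refine le_trans ?_ (le_max_right _ _)
      have hloc : (fun r => (p (ρ r)).coeff m) =ᶠ[𝓝 s] fun _ => (p y.1).coeff m := by
        filter_upwards [Metric.isClosed_closedBall.isOpen_compl.mem_nhds hs] with z hz
        rw [hR z (by simpa using hz)]
      rw [(hloc.iteratedFDeriv ℝ k).eq_of_nhds]
      have hK0 := le_trans (by positivity) (hK m)
      rcases Nat.eq_zero_or_pos k with rfl | hk
      · simpa using hK m
      · rw [iteratedFDeriv_const_of_ne hk.ne']
        simpa using hK0)
  refine key.contDiffAt.congr_of_eventuallyEq ?_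
  filter_upwards [continuous_fst.continuousAt.eventually hρy] with z hz
  simp only [fourierSynthesis, hz, id]

/-! ### The symplectic form -/

/-- The standard area form of `ℂ`,
`Surf(a, b) = (1 / 2i) (conj a * b - conj b * a)` (which is a real number). -/
noncomputable def surf : ℂ [⋀^Fin 2]→L[ℝ] ℝ where
  toFun v := (1 / (2 * Complex.I) *
    ((starRingEnd ℂ) (v 0) * v 1 - (starRingEnd ℂ) (v 1) * v 0)).re
  map_update_add' {inst} v i x y := by
    obtain rfl := Subsingleton.elim inst (instDecidableEqFin 2)
    fin_cases i <;> simp [Function.update] <;> ring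
  map_update_smul' {inst} v i c x := by
    obtain rfl := Subsingleton.elim inst (instDecidableEqFin 2)
    fin_cases i <;> simp [Function.update] <;> ring
  cont := by
    have h : Continuous fun v : Fin 2 → ℂ => (1 / (2 * Complex.I) *
      ((starRingEnd ℂ) (v 0) * v 1 - (starRingEnd ℂ) (v 1) * v 0)).re := by fun_prop
    exact h
  map_eq_zero_of_eq' v i j h hij := by
    fin_cases i <;> fin_cases j <;> simp_all


theorem surf_apply (v : Fin 2 → ℂ) : surf v = (v 0).re * (v 1).im - (v 0).im * (v 1).re := by
  change (1 / (2 * Complex.I) *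
    ((starRingEnd ℂ) (v 0) * v 1 - (starRingEnd ℂ) (v 1) * v 0)).re = _
  simp
  ring

theorem contDiff_surf_comp {E F : Type} [NormedAddCommGroup E] [NormedSpace ℝ E]
    [NormedAddCommGroup F] [NormedSpace ℝ F] {A : F → E →L[ℝ] ℂ} (hA : ContDiff ℝ ∞ A) :
    ContDiff ℝ ∞ fun y => surf.compContinuousLinearMap (A y) := by
  let S : (E →L[ℝ] ℝ) →L[ℝ] E [⋀^Fin 1]→L[ℝ] ℝ :=
    (ContinuousAlternatingMap.ofSubsingletonLIE (𝕜 := ℝ) (E := E) (F := ℝ)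
      (0 : Fin 1)).toContinuousLinearEquiv.toContinuousLinearMap
  let W : (E →L[ℝ] E →L[ℝ] ℝ) →L[ℝ] E [⋀^Fin 2]→L[ℝ] ℝ :=
    (ContinuousAlternatingMap.alternatizeUncurryFinCLM ℝ E ℝ).comp
      (ContinuousLinearMap.compL ℝ E (E →L[ℝ] ℝ) (E [⋀^Fin 1]→L[ℝ] ℝ) S)
  have h : (fun y => surf.compContinuousLinearMap (A y)) = fun y =>
      W ((Complex.reCLM.comp (A y)).smulRight (Complex.imCLM.comp (A y))) := by
    funext y
    ext v
    simp [W, S, surf_apply, ContinuousAlternatingMap.alternatizeUncurryFin_apply,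
      Fin.sum_univ_two, Fin.removeNth]
    ring
  rw [h]
  have h1 : ContDiff ℝ ∞ fun y => Complex.reCLM.comp (A y) := contDiff_const.clm_comp hA
  have h2 : ContDiff ℝ ∞ fun y => Complex.imCLM.comp (A y) := contDiff_const.clm_comp hA
  exact W.contDiff.comp (h1.smulRight h2)

theorem contDiff_intervalIntegral {F : Type} [NormedAddCommGroup F] [NormedSpace ℝ F]
    [FiniteDimensional ℝ F] {G : Type} [NormedAddCommGroup G] [NormedSpace ℝ G] [CompleteSpace G]
    {g : F × ℝ → G} (hg : ContDiff ℝ ∞ g) :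
    ContDiff ℝ ∞ fun r => ∫ x in (0 : ℝ)..1, g (r, x) := by
  refine contDiff_infty.2 fun n => ?_
  induction n generalizing G with
  | zero =>
    have hc := hg.continuous
    rw [Nat.cast_zero, contDiff_zero]
    exact intervalIntegral.continuous_parametric_intervalIntegral_of_continuous'
      (f := fun r x => g (r, x)) hc 0 1
  | succ n ih =>
    rw [Nat.cast_add, Nat.cast_one, contDiff_succ_iff_hasFDerivAt]
    have hg' : ContDiff ℝ ∞ fun y : F × ℝ => (fderiv ℝ g y).comp (ContinuousLinearMap.inl ℝ F ℝ) :=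
      (hg.fderiv_right (m := ∞) (by simp)).clm_comp contDiff_const
    refine ⟨_, ih hg', fun r => ?_⟩
    have hc := hg.continuous
    have hc' := hg'.continuous
    have : ProperSpace F := FiniteDimensional.proper_real F
    obtain ⟨C, hC⟩ := ((isCompact_closedBall r (1 : ℝ)).prod
      (isCompact_Icc (a := (0 : ℝ)) (b := 1))).exists_bound_of_continuousOn hc'.continuousOn
    refine intervalIntegral.hasFDerivAt_integral_of_dominated_of_fderiv_le (𝕜 := ℝ)
      (F := fun r x => g (r, x))
      (F' := fun r x => (fderiv ℝ g (r, x)).comp (ContinuousLinearMap.inl ℝ F ℝ)) (bound := fun _ => C) (s := Metric.closedBall r 1)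
      (Metric.closedBall_mem_nhds r one_pos) ?_ ?_ ?_ ?_ ?_ ?_
    · exact Eventually.of_forall fun s =>
        (hc.comp (Continuous.prodMk_right s)).aestronglyMeasurable
    · exact (hc.comp (Continuous.prodMk_right r)).intervalIntegrable _ _
    · exact (hc'.comp (Continuous.prodMk_right r)).aestronglyMeasurable
    · refine Eventually.of_forall fun x hx s hs => hC (s, x) ⟨hs, ?_⟩
      rw [uIoc_of_le zero_le_one] at hx
      exact ⟨hx.1.le, hx.2⟩
    · simp
    · refine Eventually.of_forall fun x _ s _ => ?_
      have h1 : HasFDerivAt g (fderiv ℝ g (s, x)) (s, x) :=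
        (hg.differentiable (by simp) (s, x)).hasFDerivAt
      exact h1.comp s (hasFDerivAt_prodMk_left s x)

/-- For a plot `r ↦ f_r`, the function `(r, x) ↦ ∂f_r(x)/∂r` is smooth. -/
theorem contDiff_partial {n : ℕ} {g : Eu n × ℝ → ℂ} (hg : ContDiff ℝ ∞ g) :
    ContDiff ℝ ∞ fun y : Eu n × ℝ => fderiv ℝ (fun s => g (s, y.2)) y.1 := by
  have h : (fun y : Eu n × ℝ => fderiv ℝ (fun s => g (s, y.2)) y.1) =
      fun y => (fderiv ℝ g y).comp (ContinuousLinearMap.inl ℝ (Eu n) ℝ) := by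
    funext y
    have h1 : HasFDerivAt g (fderiv ℝ g (y.1, y.2)) (y.1, y.2) :=
      (hg.differentiable (by simp) (y.1, y.2)).hasFDerivAt
    exact (h1.comp y.1 (hasFDerivAt_prodMk_left y.1 y.2)).fderiv
  rw [h]
  exact (hg.fderiv_right (m := ∞) (by simp)).clm_comp contDiff_const

/-- The `2`-form on the space of smooth periodic functions which is the mean value of the pullbacks
of `Surf / π` by the evaluation maps `f ↦ f(x)`:
`ω(P)_r = (1 / π) ∫_0^1 (r ↦ f_r(x))^*(Surf) dx` for each plot `P : r ↦ f_r`. -/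
noncomputable def periodicForm : DiffForm PeriodicSmooth 2 where
  eval p _ r := (1 / Real.pi) • ∫ x in (0 : ℝ)..1,
    surf.compContinuousLinearMap (fderiv ℝ (fun s => (p s).toFun x) r)
  contDiff_eval p hp :=
    (contDiff_intervalIntegral (contDiff_surf_comp (contDiff_partial hp))).const_smul _
  eval_comp {m n} p hp f hf r := by
    have hp' : ContDiff ℝ ∞ fun y : Eu m × ℝ => (p y.1).toFun y.2 := hp
    let L := ContinuousAlternatingMap.compContinuousLinearMapCLM (𝕜 := ℝ) (ι := Fin 2) (F := ℝ)
      (fderiv ℝ f r)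
    change _ = L _
    rw [map_smul, ← ContinuousLinearMap.intervalIntegral_comp_comm]
    · congr 1
      refine intervalIntegral.integral_congr fun x _ => ?_
      have h1 : DifferentiableAt ℝ (fun s => (p s).toFun x) (f r) :=
        (hp'.comp (contDiff_id.prodMk contDiff_const)).differentiable (by simp) _
      have h2 : fderiv ℝ (fun s => ((p ∘ f) s).toFun x) r =
          (fderiv ℝ (fun s => (p s).toFun x) (f r)).comp (fderiv ℝ f r) :=
        fderiv_comp r h1 (hf.differentiable (by simp) r)
      simp only [h2]
      rfl
    · have h := (contDiff_surf_comp (contDiff_partial hp')).continuous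
      exact (h.comp (Continuous.prodMk_right (f r))).intervalIntegrable _ _

/-- The symplectic form `ω` transported to the space of Fourier coefficients. -/
noncomputable def omega : DiffForm FourierSpace 2 :=
  periodicForm.pullback fourierSynthesis dSmooth_fourierSynthesis

/-! ### The solenoid action and the reduced space -/

/-- The infinite torus `∏_{n ∈ ℤ} T` acts on Fourier coefficients by pointwise multiplication. -/
noncomputable instance torusAction : MulAction (ℤ → Circle) FourierSpace where
  smul τ Z := ⟨fun n => τ n * Z.coeff n, fun q => by
    simpa only [norm_mul, Circle.norm_coe, one_mul] using Z.rapid q⟩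
  one_smul Z := by ext n; exact one_mul _
  mul_smul σ τ Z := by ext n; exact mul_assoc _ _ _

/-- The point `(e^{2πiα_n t})_n` of the infinite torus. -/
noncomputable def solenoid (α : ℤ → ℝ) (t : ℝ) : ℤ → Circle :=
  fun n => Circle.exp (2 * Real.pi * α n * t)

theorem solenoid_add (α : ℤ → ℝ) (s t : ℝ) :
    solenoid α (s + t) = solenoid α s * solenoid α t := by
  funext n
  simp [solenoid, mul_add, Circle.exp_add]

theorem solenoid_zero (α : ℤ → ℝ) : solenoid α 0 = 1 := by
  funext n
  simp [solenoid]

/-- The infinite-dimensional ellipsoid `∑ α_n |Z_n|² = 1`. -/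
def ellipsoid (α : ℤ → ℝ) : Set FourierSpace :=
  {Z | ∑' n, α n * ‖Z.coeff n‖ ^ 2 = 1}

/-- The partition of the ellipsoid into orbits of the solenoid action of `ℝ`. -/
def orbitSetoid (α : ℤ → ℝ) : Setoid (ellipsoid α) where
  r Z Y := ∃ t : ℝ, solenoid α t • Z.1 = Y.1
  iseqv :=
    { refl := fun Z => ⟨0, by rw [solenoid_zero, one_smul]⟩
      symm := fun {Z Y} ⟨t, ht⟩ => ⟨-t, by
        rw [← ht, ← mul_smul, ← solenoid_add, neg_add_cancel, solenoid_zero, one_smul]⟩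
      trans := fun {Z Y X} ⟨s, hs⟩ ⟨t, ht⟩ => ⟨t + s, by
        rw [← ht, ← hs, ← mul_smul, ← solenoid_add]⟩ }

/-- The infinite quasi-projective space, quotient of the ellipsoid by the solenoid action,
with the quotient diffeology. -/
abbrev QuasiProjective (α : ℤ → ℝ) : Type := Quotient (orbitSetoid α)

/-- The points of the ellipsoid all of whose coordinates, except the `n`-th one, vanish. -/
def singularCircle (α : ℤ → ℝ) (n : ℤ) : Set FourierSpace :=
  {Z | Z ∈ ellipsoid α ∧ ∀ m, m ≠ n → Z.coeff m = 0}

/-- The standard diffeology of `ℂ`. -/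
noncomputable instance complexDiffeology : DiffeologicalSpace ℂ := NormedSpace.toDiffeology ℂ

end EllipsoidReduction

open EllipsoidReduction Diffeology

/-! The statements on orbits reduce to one coordinate at a time: a nonzero `Z_n` is fixed at time
`t` iff `α_n t` is an integer. Two nonzero coordinates would therefore turn a nonzero period into a
rational relation between two of the `α_n`.

The form on periodic functions is an average over `x` of pullbacks of the constant area form of `ℂ`
by evaluation at `x`, so it is closed (`isClosed_periodicForm`), and so is its pullback `omega`. By
Parseval, `ω = (1/π) ∑ Surf(dZ_m, dZ_m)` (`omega_eval`).

Descent to the quotient requires that two plots `p`, `q` of the ellipsoid with the same projection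
give the same form. If `q = solenoid α s • p` with `s` differentiable, the two values differ by a
multiple of `ds ∧ d(∑ α_m |Z_m|²)`, which vanishes because the sum is constant on the ellipsoid
(`omega_eval_eq_of_smooth_phase`).

The difficulty is that the time `s` is only known to exist pointwise. Where two coordinates are
nonzero, each of them gives a smooth time up to a discrete ambiguity, and rational independence
together with a connectedness argument makes both times equal to the true one
(`exists_phase_of_pair`). Where a single coordinate is nonzero on a whole neighbourhood, that
coordinate suffices (`exists_phase_of_single`). Every other point is a limit of points of the first
kind, and continuity of the forms concludes (`isBasic_ellipsoidForm`). -/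

namespace EllipsoidReduction

open Filter Topology Set Diffeology
open scoped ContDiff

/-! ### Descent of basic forms to a quotient -/

namespace DiffForm

variable {X : Type*} [DiffeologicalSpace X] {k : ℕ}

/-- A form takes the same values at `r` on any two plots that have the same
projection to the quotient near `r`. -/
def IsBasic (s : Setoid X) (α : DiffForm X k) : Prop :=
  ∀ (n : ℕ) (p q : Eu n → X) (hp : IsPlot p) (hq : IsPlot q) (r : Eu n),
    (∀ᶠ y in 𝓝 r, s (p y) (q y)) → α.eval p hp r = α.eval q hq r

theorem exists_lift {s : Setoid X} {n : ℕ} {p : Eu n → Quotient s} (hp : IsPlot p) (r : Eu n) :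
    ∃ q : Eu n → X, IsPlot q ∧ p =ᶠ[𝓝 r] fun y => Quotient.mk s (q y) := hp r

/-- The lift selected by `choose` varies with `r` without any regularity. Basicness makes the
selection irrelevant, so that any convenient lift can replace it. -/
theorem IsBasic.eval_lift {s : Setoid X} {α : DiffForm X k} (hα : α.IsBasic s) {n : ℕ}
    {p : Eu n → Quotient s} (hp : IsPlot p) {r : Eu n} {q : Eu n → X} (hq : IsPlot q)
    (h : p =ᶠ[𝓝 r] fun y => Quotient.mk s (q y)) :
    α.eval (exists_lift hp r).choose (exists_lift hp r).choose_spec.1 r = α.eval q hq r := by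
  refine hα n _ _ _ hq r ?_
  filter_upwards [(exists_lift hp r).choose_spec.2, h] with y h1 h2
  exact Quotient.exact (h1.symm.trans h2)

/-- The form on the quotient induced by a basic form. -/
noncomputable def descend {s : Setoid X} {α : DiffForm X k} (hα : α.IsBasic s) :
    DiffForm (Quotient s) k where
  eval p hp r := α.eval (exists_lift hp r).choose (exists_lift hp r).choose_spec.1 r
  contDiff_eval p hp := contDiff_iff_contDiffAt.2 fun r => by
    obtain ⟨q, hq, h⟩ := exists_lift hp r
    refine (α.contDiff_eval q hq).contDiffAt.congr_of_eventuallyEq ?_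
    -- A lift valid near `r` is valid near each `y` close to `r`, so the single plot `q` computes
    -- the descended form on a neighbourhood.
    filter_upwards [h.eventually_nhds] with y hy
    exact hα.eval_lift hp hq hy
  eval_comp p hp f hf r := by
    obtain ⟨q, hq, h⟩ := exists_lift hp (f r)
    rw [hα.eval_lift hp hq h, hα.eval_lift (isPlot_reparam hp hf) (isPlot_reparam hq hf)
      (hf.continuous.continuousAt.eventually h), α.eval_comp q hq f hf]

theorem descend_eval {s : Setoid X} {α : DiffForm X k} (hα : α.IsBasic s) {n : ℕ}
    {p : Eu n → Quotient s} (hp : IsPlot p) {r : Eu n} {q : Eu n → X} (hq : IsPlot q)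
    (h : p =ᶠ[𝓝 r] fun y => Quotient.mk s (q y)) :
    (descend hα).eval p hp r = α.eval q hq r :=
  hα.eval_lift hp hq h

theorem pullback_descend {s : Setoid X} {α : DiffForm X k} (hα : α.IsBasic s) :
    (descend hα).pullback (Quotient.mk s) (dSmooth_mk s) = α := by
  ext n p hp r : 5
  exact descend_eval hα (dSmooth_mk s n p hp) hp .rfl

theorem isClosed_descend {s : Setoid X} {α : DiffForm X k} (hα : α.IsBasic s) (hc : α.IsClosed) :
    (descend hα).IsClosed := by
  intro n p hp
  funext r
  obtain ⟨q, hq, h⟩ := exists_lift hp r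
  have : (descend hα).eval p hp =ᶠ[𝓝 r] α.eval q hq := by
    filter_upwards [h.eventually_nhds] with y hy
    exact descend_eval hα hp hq hy
  rw [this.extDeriv_eq, hc n q hq]

theorem IsClosed.pullback {Y : Type*} [DiffeologicalSpace Y] {β : DiffForm Y k} (hβ : β.IsClosed)
    (f : X → Y) (hf : DSmooth f) : (β.pullback f hf).IsClosed :=
  fun n _ hp => hβ n _ (hf n _ hp)

end DiffForm

/-! ### Closedness of the form -/

/-- Differentiation under the integral sign. -/
theorem fderiv_intervalIntegral {F : Type} [NormedAddCommGroup F] [NormedSpace ℝ F]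
    [FiniteDimensional ℝ F] {G : Type} [NormedAddCommGroup G] [NormedSpace ℝ G] [CompleteSpace G]
    {g : F × ℝ → G} (hg : ContDiff ℝ ∞ g) (r : F) :
    Continuous (fun x : ℝ => fderiv ℝ (fun s => g (s, x)) r) ∧
    fderiv ℝ (fun s => ∫ x in (0 : ℝ)..1, g (s, x)) r =
      ∫ x in (0 : ℝ)..1, fderiv ℝ (fun s => g (s, x)) r := by
  have h' : ∀ s x, HasFDerivAt (fun s => g (s, x))
      ((fderiv ℝ g (s, x)).comp (ContinuousLinearMap.inl ℝ F ℝ)) s := fun s x => by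
    have h1 : HasFDerivAt g (fderiv ℝ g (s, x)) (s, x) :=
      (hg.differentiable (by simp) (s, x)).hasFDerivAt
    exact h1.comp s (hasFDerivAt_prodMk_left s x)
  simp only [(h' _ _).fderiv]
  have hc := hg.continuous
  have hc' : Continuous fun y : F × ℝ =>
      (fderiv ℝ g y).comp (ContinuousLinearMap.inl ℝ F ℝ) :=
    ((hg.continuous_fderiv (by simp)).clm_comp continuous_const)
  refine ⟨hc'.comp (Continuous.prodMk_right r), HasFDerivAt.fderiv ?_⟩
  have : ProperSpace F := FiniteDimensional.proper_real F
  obtain ⟨C, hC⟩ := ((isCompact_closedBall r (1 : ℝ)).prod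
    (isCompact_Icc (a := (0 : ℝ)) (b := 1))).exists_bound_of_continuousOn hc'.continuousOn
  refine intervalIntegral.hasFDerivAt_integral_of_dominated_of_fderiv_le (𝕜 := ℝ)
    (F := fun r x => g (r, x))
    (F' := fun r x => (fderiv ℝ g (r, x)).comp (ContinuousLinearMap.inl ℝ F ℝ))
    (bound := fun _ => C) (s := Metric.closedBall r 1)
    (Metric.closedBall_mem_nhds r one_pos) ?_ ?_ ?_ ?_ ?_ ?_
  · exact Eventually.of_forall fun s =>
      (hc.comp (Continuous.prodMk_right s)).aestronglyMeasurable
  · exact (hc.comp (Continuous.prodMk_right r)).intervalIntegrable _ _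
  · exact (hc'.comp (Continuous.prodMk_right r)).aestronglyMeasurable
  · refine Eventually.of_forall fun x hx s hs => hC (s, x) ⟨hs, ?_⟩
    rw [uIoc_of_le zero_le_one] at hx
    exact ⟨hx.1.le, hx.2⟩
  · simp
  · exact Eventually.of_forall fun x _ s _ => h' s x

theorem extDeriv_const_zero {E F : Type*} [NormedAddCommGroup E] [NormedSpace ℝ E]
    [NormedAddCommGroup F] [NormedSpace ℝ F] {k : ℕ} (c : E [⋀^Fin k]→L[ℝ] F) (x : E) :
    extDeriv (fun _ : E => c) x = 0 := by
  rw [extDeriv, fderiv_fun_const]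
  exact map_zero (ContinuousAlternatingMap.alternatizeUncurryFinCLM ℝ E F)

/-- For fixed `x` the integrand is the pullback of the constant form `surf` by `s ↦ f_s(x)`, and the
exterior derivative commutes with pullback. It also passes under the integral, being a continuous
linear alternation applied to the derivative. -/
theorem isClosed_periodicForm : periodicForm.IsClosed := by
  intro n p hp
  funext r
  have hp' : ContDiff ℝ ∞ fun y : Eu n × ℝ => (p y.1).toFun y.2 := hp
  let g : Eu n × ℝ → Eu n [⋀^Fin 2]→L[ℝ] ℝ := fun y =>
    surf.compContinuousLinearMap (fderiv ℝ (fun s => (p s).toFun y.2) y.1)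
  have hg : ContDiff ℝ ∞ g := contDiff_surf_comp (contDiff_partial hp')
  have h0 : ∀ x, extDeriv (fun s => g (s, x)) r = 0 := fun x => by
    have h1 : ContDiff ℝ ∞ fun s => (p s).toFun x :=
      hp'.comp (contDiff_id.prodMk contDiff_const)
    have hs : DifferentiableAt ℝ (fun _ : ℂ => surf) ((p r).toFun x) := differentiableAt_const _
    have h2 := extDeriv_pullback (f := fun s => (p s).toFun x) hs
      (contDiff_infty.1 h1 2).contDiffAt (by simp)
    refine h2.trans ?_
    rw [extDeriv_const_zero]
    rfl
  change extDeriv ((1 / Real.pi) • fun r => ∫ x in (0 : ℝ)..1, g (r, x)) r = 0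
  obtain ⟨hc, hd⟩ := fderiv_intervalIntegral hg r
  rw [extDeriv_smul, extDeriv, hd]
  have h3 := (ContinuousAlternatingMap.alternatizeUncurryFinCLM ℝ (Eu n)
    ℝ (n := 2)).intervalIntegral_comp_comm (hc.intervalIntegrable (μ := MeasureTheory.volume) 0 1)
  simp only [ContinuousAlternatingMap.alternatizeUncurryFinCLM_apply] at h3
  rw [← h3]
  simp only [extDeriv] at h0
  simp [h0]

theorem isClosed_omega : omega.IsClosed := isClosed_periodicForm.pullback _ _

/-! ### Fourier expansion of the form -/

theorem norm_character (m : ℤ) (x : ℝ) : ‖character m x‖ = 1 := by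
  simpa using norm_iteratedFDeriv_character 0 m x

theorem continuous_character (m : ℤ) : Continuous (character m) :=
  (contDiff_character m).continuous

theorem conj_character_mul (m n : ℤ) (x : ℝ) :
    starRingEnd ℂ (character m x) * character n x = character (n - m) x := by
  simp only [character, ← Complex.exp_conj, ← Complex.exp_add]
  congr 1
  simp [Complex.conj_ofNat]
  ring

theorem integral_character (m : ℤ) :
    ∫ x in (0 : ℝ)..1, character m x = if m = 0 then 1 else 0 := by
  split_ifs with hm
  · simp [hm, character]
  · have hc : 2 * (Real.pi : ℂ) * Complex.I * m ≠ 0 := by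
      simp [Real.pi_ne_zero, hm]
    simp only [character]
    rw [integral_exp_mul_complex hc]
    have : 2 * (Real.pi : ℂ) * Complex.I * m * ((1 : ℝ) : ℂ) = m * (2 * Real.pi * Complex.I) := by
      push_cast
      ring
    rw [this, Complex.exp_int_mul_two_pi_mul_I]
    simp

/-- Dominated convergence, with dominating series `‖b m‖ * K`. Parseval uses it twice: with `g` a
conjugate character, to extract a coefficient, and with `g` a conjugate series. -/
theorem hasSum_integral_mul_character {g : ℝ → ℂ} (hg : Continuous g) {K : ℝ}
    (hK : ∀ x, ‖g x‖ ≤ K) {b : ℤ → ℂ} (hb : Summable fun m => ‖b m‖) :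
    HasSum (fun m => b m * ∫ x in (0 : ℝ)..1, g x * character m x)
      (∫ x in (0 : ℝ)..1, g x * ∑' m, b m * character m x) := by
  have h := intervalIntegral.hasSum_integral_of_dominated_convergence (ι := ℤ)
    (μ := MeasureTheory.volume) (a := 0) (b := 1)
    (F := fun m x => b m * (g x * character m x))
    (f := fun x => g x * ∑' m, b m * character m x) (fun m _ => ‖b m‖ * K)
    (fun m => (continuous_const.mul
      (hg.mul (continuous_character m))).aestronglyMeasurable) ?_ ?_ ?_ ?_
  · simpa only [intervalIntegral.integral_const_mul] using h
  · refine fun m => Eventually.of_forall fun x _ => ?_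
    rw [norm_mul, norm_mul, norm_character, mul_one]
    gcongr
    exact hK x
  · exact Eventually.of_forall fun x _ => hb.mul_right K
  · exact intervalIntegrable_const
  · refine Eventually.of_forall fun x _ => ?_
    have h1 : Summable fun m => b m * character m x :=
      Summable.of_norm (by simpa only [norm_mul, norm_character, mul_one] using hb)
    have h2 := h1.hasSum.mul_left (g x)
    simpa only [mul_left_comm] using h2

theorem continuous_characterSeries {a : ℤ → ℂ} (ha : Summable fun m => ‖a m‖) :
    Continuous fun x => ∑' m, a m * character m x :=
  continuous_tsum (fun m => continuous_const.mul (continuous_character m)) ha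
    fun m x => by rw [norm_mul, norm_character, mul_one]

theorem norm_characterSeries_le {a : ℤ → ℂ} (ha : Summable fun m => ‖a m‖) (x : ℝ) :
    ‖∑' m, a m * character m x‖ ≤ ∑' m, ‖a m‖ :=
  tsum_of_norm_bounded ha.hasSum fun m => by rw [norm_mul, norm_character, mul_one]

/-- Parseval's identity for absolutely summable Fourier series. -/
theorem hasSum_parseval {a b : ℤ → ℂ} (ha : Summable fun m => ‖a m‖)
    (hb : Summable fun m => ‖b m‖) :
    HasSum (fun m => starRingEnd ℂ (a m) * b m)
      (∫ x in (0 : ℝ)..1, starRingEnd ℂ (∑' m, a m * character m x) *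
        ∑' m, b m * character m x) := by
  have key : ∀ n, ∫ x in (0 : ℝ)..1, starRingEnd ℂ (∑' m, a m * character m x) * character n x =
      starRingEnd ℂ (a n) := fun n => by
    have h := hasSum_integral_mul_character (g := fun x => starRingEnd ℂ (character n x))
      (Complex.continuous_conj.comp (continuous_character n)) (K := 1)
      (fun x => by rw [RCLike.norm_conj, norm_character]) ha
    simp only [conj_character_mul, integral_character, sub_eq_zero] at h
    have h1 := h.unique (hasSum_single n fun m hm => by simp [hm])
    -- `h1` has the conjugate on the character; conjugating the identity moves it to the series.
    have h2 := congrArg (starRingEnd ℂ) h1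
    rw [← intervalIntegral.intervalIntegral_conj] at h2
    simpa [mul_comm] using h2
  have h := hasSum_integral_mul_character
    (Complex.continuous_conj.comp (continuous_characterSeries ha))
    (fun x => by
      rw [Function.comp_apply, RCLike.norm_conj]
      exact norm_characterSeries_le ha x) hb
  simp only [Function.comp_apply, key] at h
  simpa only [mul_comm] using h

theorem surf_eq_im (v : Fin 2 → ℂ) : surf v = (starRingEnd ℂ (v 0) * v 1).im := by
  rw [surf_apply]
  simp
  ring

/-- Since `surf ![a, b]` is the imaginary part of `conj a * b`, this is the imaginary part of
Parseval's identity. -/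
theorem hasSum_surf {a b : ℤ → ℂ} (ha : Summable fun m => ‖a m‖)
    (hb : Summable fun m => ‖b m‖) :
    HasSum (fun m => surf ![a m, b m])
      (∫ x in (0 : ℝ)..1, surf ![∑' m, a m * character m x, ∑' m, b m * character m x]) := by
  have h := (Complex.imCLM.hasSum (hasSum_parseval ha hb))
  rw [← Complex.imCLM.intervalIntegral_comp_comm] at h
  · simpa [surf_eq_im] using h
  · exact ((Complex.continuous_conj.comp (continuous_characterSeries ha)).mul
      (continuous_characterSeries hb)).intervalIntegrable _ _

/-- Near a given point, a rapid family and its derivatives are bounded by a summable sequence. -/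
theorem IsRapidFamily.exists_ball {n : ℕ} {c : ℤ → Eu n → ℂ} (hc : IsRapidFamily c) (r : Eu n) :
    ∃ ε > 0, ∃ C : ℝ, 0 ≤ C ∧ ∀ s ∈ Metric.ball r ε, ∀ m : ℤ,
      ‖c m s‖ ≤ C * ((1 + |(m : ℝ)|) ^ 2)⁻¹ ∧
      ‖fderiv ℝ (c m) s‖ ≤ C * ((1 + |(m : ℝ)|) ^ 2)⁻¹ := by
  obtain ⟨C, hC⟩ := (isRapidFamily_iff.1 hc).2 0 2 r
  obtain ⟨D, hD⟩ := (isRapidFamily_iff.1 hc).2 1 2 r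
  obtain ⟨ε, hε, h⟩ := Metric.eventually_nhds_iff_ball.1 (hC.and hD)
  refine ⟨ε, hε, max 0 (max C D), le_max_left _ _, fun s hs m => ?_⟩
  have hpos : (0 : ℝ) < (1 + |(m : ℝ)|) ^ 2 := by positivity
  rw [← div_eq_mul_inv, le_div_iff₀ hpos, le_div_iff₀ hpos, mul_comm, mul_comm _ (_ ^ 2)]
  obtain ⟨h1, h2⟩ := h s hs
  have h1 := h1 m
  have h2 := h2 m
  rw [norm_iteratedFDeriv_zero] at h1
  rw [norm_iteratedFDeriv_one] at h2
  exact ⟨h1.trans ((le_max_left _ _).trans (le_max_right _ _)),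
    h2.trans ((le_max_right _ _).trans (le_max_right _ _))⟩

theorem IsRapidFamily.hasFDerivAt {n : ℕ} {c : ℤ → Eu n → ℂ} (hc : IsRapidFamily c) (m : ℤ)
    (r : Eu n) : HasFDerivAt (c m) (fderiv ℝ (c m) r) r :=
  ((hc.1 m).differentiable (by simp) r).hasFDerivAt

theorem IsRapidFamily.summable_norm {n : ℕ} {c : ℤ → Eu n → ℂ} (hc : IsRapidFamily c)
    (r : Eu n) : Summable fun m => ‖c m r‖ := by
  obtain ⟨ε, hε, C, -, h⟩ := hc.exists_ball r
  exact (summable_inv_one_add_sq.mul_left C).of_nonneg_of_le (fun _ => norm_nonneg _)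
    fun m => (h r (Metric.mem_ball_self hε) m).1

theorem IsRapidFamily.summable_norm_fderiv {n : ℕ} {c : ℤ → Eu n → ℂ} (hc : IsRapidFamily c)
    (r : Eu n) : Summable fun m => ‖fderiv ℝ (c m) r‖ := by
  obtain ⟨ε, hε, C, -, h⟩ := hc.exists_ball r
  exact (summable_inv_one_add_sq.mul_left C).of_nonneg_of_le (fun _ => norm_nonneg _)
    fun m => (h r (Metric.mem_ball_self hε) m).2

theorem IsRapidFamily.summable_norm_fderiv_apply {n : ℕ} {c : ℤ → Eu n → ℂ}
    (hc : IsRapidFamily c) (r v : Eu n) : Summable fun m => ‖fderiv ℝ (c m) r v‖ :=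
  ((hc.summable_norm_fderiv r).mul_right ‖v‖).of_nonneg_of_le (fun _ => norm_nonneg _)
    fun _ => ContinuousLinearMap.le_opNorm _ _

/-- Characters have modulus one, so the summable bound on the derivatives of the coefficients over a
ball allows termwise differentiation. -/
theorem IsRapidFamily.fderiv_characterSeries {n : ℕ} {c : ℤ → Eu n → ℂ} (hc : IsRapidFamily c)
    (x : ℝ) (r v : Eu n) :
    fderiv ℝ (fun s => ∑' m, c m s * character m x) r v =
      ∑' m, fderiv ℝ (c m) r v * character m x := by
  obtain ⟨ε, hε, C, -, h⟩ := hc.exists_ball r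
  have hr := Metric.mem_ball_self (x := r) hε
  have hb : ∀ m : ℤ, ∀ s ∈ Metric.ball r ε,
      ‖character m x • fderiv ℝ (c m) s‖ ≤ C * ((1 + |(m : ℝ)|) ^ 2)⁻¹ := fun m s hs => by
    rw [norm_smul, norm_character, one_mul]
    exact (h s hs m).2
  have h1 := hasFDerivAt_tsum_of_isPreconnected (𝕜 := ℝ)
    (summable_inv_one_add_sq.mul_left C) Metric.isOpen_ball
    (convex_ball r ε).isPreconnected
    (fun m s _ => (hc.hasFDerivAt m s).mul_const (character m x)) hb hr
    (Summable.of_norm (by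
      simpa only [norm_mul, norm_character, mul_one] using hc.summable_norm r)) hr
  rw [h1.fderiv]
  have h2 : Summable fun m => character m x • fderiv ℝ (c m) r := Summable.of_norm
    ((summable_inv_one_add_sq.mul_left C).of_nonneg_of_le (fun _ => norm_nonneg _)
      fun m => hb m r hr)
  have h3 := (ContinuousLinearMap.apply ℝ ℂ v).map_tsum h2
  simpa [mul_comm] using h3

theorem isRapidFamily_coeff {n : ℕ} {p : Eu n → FourierSpace} (hp : IsPlot p) :
    IsRapidFamily fun m r => (p r).coeff m := hp

/-- The form `ω` in terms of Fourier coefficients: `ω = (1 / π) ∑ Surf(dZ_m, dZ_m)`. -/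
theorem omega_eval {n : ℕ} {p : Eu n → FourierSpace} (hp : IsPlot p) (r : Eu n)
    (v : Fin 2 → Eu n) :
    omega.eval p hp r v = (1 / Real.pi) * ∑' m, surf
      ![fderiv ℝ (fun s => (p s).coeff m) r (v 0), fderiv ℝ (fun s => (p s).coeff m) r (v 1)] := by
  have hc := isRapidFamily_coeff hp
  have hp' : ContDiff ℝ ∞ fun y : Eu n × ℝ => (fourierSynthesis (p y.1)).toFun y.2 :=
    dSmooth_fourierSynthesis n p hp
  have hi := ((contDiff_surf_comp (contDiff_partial hp')).continuous.comp
    (Continuous.prodMk_right r)).intervalIntegrable (μ := MeasureTheory.volume) 0 1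
  rw [(hasSum_surf (hc.summable_norm_fderiv_apply r (v 0))
    (hc.summable_norm_fderiv_apply r (v 1))).tsum_eq]
  simp only [← hc.fderiv_characterSeries]
  change (1 / Real.pi) * (∫ x in (0 : ℝ)..1, surf.compContinuousLinearMap
    (fderiv ℝ (fun s => (fourierSynthesis (p s)).toFun x) r)) v = _
  congr 1
  have h := (ContinuousAlternatingMap.apply ℝ (Eu n) ℝ v).intervalIntegral_comp_comm hi
  refine h.symm.trans ?_
  refine intervalIntegral.integral_congr fun x _ => ?_
  change surf.compContinuousLinearMap
    (fderiv ℝ (fun s => (fourierSynthesis (p s)).toFun x) r) v = _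
  rw [ContinuousAlternatingMap.compContinuousLinearMap_apply]
  refine congrArg surf (funext fun i => ?_)
  fin_cases i <;> rfl

/-! ### Invariance under smooth motion along the orbits -/

theorem solenoid_smul_coeff (α : ℤ → ℝ) (t : ℝ) (Z : FourierSpace) (n : ℤ) :
    (solenoid α t • Z).coeff n = Complex.exp (2 * Real.pi * α n * t * Complex.I) * Z.coeff n := by
  change (Circle.exp (2 * Real.pi * α n * t) : ℂ) * Z.coeff n = _
  rw [Circle.coe_exp]
  push_cast
  rfl

theorem norm_solenoid_smul_coeff (α : ℤ → ℝ) (t : ℝ) (Z : FourierSpace) (n : ℤ) :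
    ‖(solenoid α t • Z).coeff n‖ = ‖Z.coeff n‖ := by
  change ‖(Circle.exp (2 * Real.pi * α n * t) : ℂ) * Z.coeff n‖ = _
  rw [norm_mul, Circle.norm_coe, one_mul]

/-- The derivative of the constant function `∑ α_m |Z_m|²` vanishes along a plot. -/
theorem hasSum_inner_fderiv_eq_zero {α : ℤ → ℝ} (hα : ∀ m, |α m| ≤ 1) {n : ℕ}
    {p : Eu n → FourierSpace} (hp : IsPlot p) {r : Eu n} (hr : ∀ᶠ y in 𝓝 r, p y ∈ ellipsoid α)
    (v : Eu n) :
    HasSum (fun m => α m * inner ℝ ((p r).coeff m) (fderiv ℝ (fun s => (p s).coeff m) r v)) 0 := by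
  have hc := isRapidFamily_coeff hp
  obtain ⟨ε, hε, C, hC, h⟩ := hc.exists_ball r
  have hr' := Metric.mem_ball_self (x := r) hε
  let f' : ℤ → Eu n → Eu n →L[ℝ] ℝ := fun m s =>
    α m • (2 • (innerSL ℝ ((p s).coeff m)).comp (fderiv ℝ (fun s => (p s).coeff m) s))
  -- In each product of a coefficient with a coefficient or a derivative, one factor is bounded by
  -- `C` and the other keeps the summable weight.
  have hle : ∀ m : ℤ, ((1 + |(m : ℝ)|) ^ 2)⁻¹ ≤ 1 := fun m =>
    inv_le_one_of_one_le₀ (one_le_pow₀ (by linarith [abs_nonneg (m : ℝ)]))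
  have hb : ∀ m : ℤ, ∀ s ∈ Metric.ball r ε, ‖f' m s‖ ≤ 2 * C * C * ((1 + |(m : ℝ)|) ^ 2)⁻¹ := by
    intro m s hs
    obtain ⟨h1, h2⟩ := h s hs m
    have h1' : ‖(p s).coeff m‖ ≤ C := h1.trans (mul_le_of_le_one_right hC (hle m))
    calc ‖f' m s‖ ≤ 1 * (2 * (C * (C * ((1 + |(m : ℝ)|) ^ 2)⁻¹))) := by
          rw [norm_smul, two_smul, ← two_smul ℝ, norm_smul]
          refine mul_le_mul (hα m) ?_ (by positivity) zero_le_one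
          rw [Real.norm_ofNat]
          gcongr
          refine (ContinuousLinearMap.opNorm_comp_le _ _).trans ?_
          rw [innerSL_apply_norm]
          gcongr
      _ = _ := by ring
  have hsq : ∀ m s, ‖α m * ‖(p s).coeff m‖ ^ 2‖ ≤ ‖(p s).coeff m‖ ^ 2 := fun m s => by
    rw [norm_mul, Real.norm_eq_abs, norm_pow, norm_norm]
    exact mul_le_of_le_one_left (by positivity) (hα m)
  have hs0 : Summable fun m => α m * ‖(p r).coeff m‖ ^ 2 := by
    refine Summable.of_norm_bounded (summable_inv_one_add_sq.mul_left (C * C)) fun m =>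
      (hsq m r).trans ?_
    obtain ⟨h1, -⟩ := h r hr' m
    have h1' : ‖(p r).coeff m‖ ≤ C := h1.trans (mul_le_of_le_one_right hC (hle m))
    calc ‖(p r).coeff m‖ ^ 2 = ‖(p r).coeff m‖ * ‖(p r).coeff m‖ := sq _
      _ ≤ C * (C * ((1 + |(m : ℝ)|) ^ 2)⁻¹) := by gcongr
      _ = _ := by ring
  have h1 := hasFDerivAt_tsum_of_isPreconnected (𝕜 := ℝ)
    (summable_inv_one_add_sq.mul_left (2 * C * C)) Metric.isOpen_ball
    (convex_ball r ε).isPreconnected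
    (fun m s _ => ((hc.hasFDerivAt m s).norm_sq.const_mul (α m))) hb hr' hs0 hr'
  -- The plot stays in the ellipsoid near `r`, so the differentiated series is locally the constant
  -- `1` and its derivative `∑ f' m r` is zero.
  have h2 : (fun s => ∑' m, α m * ‖(p s).coeff m‖ ^ 2) =ᶠ[𝓝 r] fun _ => 1 := hr
  have h3 : ∑' m, f' m r = 0 :=
    (h1.congr_of_eventuallyEq h2.symm).unique (hasFDerivAt_const 1 r)
  have h4 : Summable fun m => f' m r := Summable.of_norm
    ((summable_inv_one_add_sq.mul_left (2 * C * C)).of_nonneg_of_le (fun _ => norm_nonneg _)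
      fun m => hb m r hr')
  have h5 := (ContinuousLinearMap.apply ℝ ℝ v).hasSum h4.hasSum
  rw [h3] at h5
  have h6 := h5.mul_left (1 / 2)
  have h7 : (fun m => 1 / 2 * ContinuousLinearMap.apply ℝ ℝ v (f' m r)) = fun m =>
      α m * inner ℝ ((p r).coeff m) (fderiv ℝ (fun s => (p s).coeff m) r v) := funext fun m => by
    simp only [f', ContinuousLinearMap.apply_apply, smul_apply,
      ContinuousLinearMap.comp_apply, innerSL_apply_apply, smul_eq_mul, nsmul_eq_mul]
    push_cast
    ring
  rw [h7] at h6
  simpa using h6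

/-- Rotation by `e` preserves area, and the two added vectors are both real multiples of `i z`, so
their mutual area vanishes. Only the cross terms remain, and `surf ![a, i z]` is the real inner
product of `z` and `a`. -/
theorem surf_rotate {e : ℂ} (he : ‖e‖ = 1) (a b z : ℂ) (x y : ℝ) :
    surf ![e * (a + x * Complex.I * z), e * (b + y * Complex.I * z)] =
      surf ![a, b] + (y * inner ℝ z a - x * inner ℝ z b) := by
  have h : e.re * e.re + e.im * e.im = 1 := by
    rw [← Complex.normSq_apply, Complex.normSq_eq_norm_sq, he, one_pow]
  simp [surf_apply, Complex.inner]
  linear_combination ((a.re - x * z.im) * (b.im + y * z.re) -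
    (a.im + x * z.re) * (b.re - y * z.im)) * h

/-- The form `ω` takes the same values on two plots of the ellipsoid that differ by a smooth
motion along the orbits. -/
theorem omega_eval_eq_of_smooth_phase {α : ℤ → ℝ} (hα : ∀ m, |α m| ≤ 1) {n : ℕ}
    {p q : Eu n → FourierSpace} (hp : IsPlot p) (hq : IsPlot q) {r : Eu n}
    (hr : ∀ᶠ y in 𝓝 r, p y ∈ ellipsoid α) {s : Eu n → ℝ} (hs : DifferentiableAt ℝ s r)
    (h : ∀ᶠ y in 𝓝 r, solenoid α (s y) • p y = q y) :
    omega.eval p hp r = omega.eval q hq r := by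
  have hc := isRapidFamily_coeff hp
  ext v
  rw [omega_eval, omega_eval]
  congr 1
  -- Product rule: the varying phase adds a component along the orbit direction `i Z_m`, with real
  -- coefficient `2π α_m ds(w)`.
  have hd : ∀ m w, fderiv ℝ (fun s => (q s).coeff m) r w =
      Complex.exp (2 * Real.pi * α m * s r * Complex.I) *
        (fderiv ℝ (fun s => (p s).coeff m) r w +
          ((2 * Real.pi * α m * fderiv ℝ s r w : ℝ) : ℂ) * Complex.I * (p r).coeff m) := by
    intro m w
    have h1 : (fun y => (q y).coeff m) =ᶠ[𝓝 r]
        fun y => Complex.exp (2 * Real.pi * α m * s y * Complex.I) * (p y).coeff m := by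
      filter_upwards [h] with y hy
      rw [← hy, solenoid_smul_coeff]
    have h2 : HasFDerivAt (fun y => 2 * Real.pi * α m * (s y : ℂ) * Complex.I) _ r :=
      ((Complex.ofRealCLM.hasFDerivAt.comp r hs.hasFDerivAt).const_mul
        (2 * Real.pi * α m : ℂ)).mul_const Complex.I
    have h3 := h1.fderiv_eq.trans (HasFDerivAt.fderiv (h2.cexp.mul (hc.hasFDerivAt m r)))
    rw [h3]
    simp
    ring
  have hsum : HasSum (fun m => surf ![fderiv ℝ (fun s => (p s).coeff m) r (v 0),
      fderiv ℝ (fun s => (p s).coeff m) r (v 1)]) _ :=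
    hasSum_surf (hc.summable_norm_fderiv_apply r (v 0)) (hc.summable_norm_fderiv_apply r (v 1))
  -- The cross terms from `surf_rotate` sum to `2π ds(v 1)` and `2π ds(v 0)` times half the
  -- derivative of `∑ α_m |Z_m|²`. Each of these sums is zero on the ellipsoid.
  have h0 := (hasSum_inner_fderiv_eq_zero hα hp hr (v 0)).mul_left
    (2 * Real.pi * fderiv ℝ s r (v 1))
  have h1 := (hasSum_inner_fderiv_eq_zero hα hp hr (v 1)).mul_left
    (2 * Real.pi * fderiv ℝ s r (v 0))
  have htot := hsum.add (h0.sub h1)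
  rw [mul_zero, mul_zero, sub_zero, add_zero] at htot
  rw [hsum.tsum_eq, ← htot.tsum_eq]
  refine tsum_congr fun m => ?_
  rw [hd, hd, surf_rotate]
  · ring
  · rw [show 2 * (Real.pi : ℂ) * α m * s r * Complex.I =
      ((2 * Real.pi * α m * s r : ℝ) : ℂ) * Complex.I by push_cast; ring]
    exact Complex.norm_exp_ofReal_mul_I _

/-! ### Smooth local choice of the time along the orbits -/

theorem exp_phase_eq_iff (a s t : ℝ) :
    Complex.exp (2 * Real.pi * a * s * Complex.I) = Complex.exp (2 * Real.pi * a * t * Complex.I) ↔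
      ∃ k : ℤ, a * s = a * t + k := by
  rw [Complex.exp_eq_exp_iff_exists_int]
  refine exists_congr fun k => ?_
  have h2 : (2 * Real.pi * Complex.I : ℂ) ≠ 0 := Complex.two_pi_I_ne_zero
  rw [show (2 * Real.pi * a * s * Complex.I : ℂ) = (a * s) * (2 * Real.pi * Complex.I) by ring,
    show (2 * Real.pi * a * t * Complex.I + k * (2 * Real.pi * Complex.I) : ℂ) =
      (a * t + k) * (2 * Real.pi * Complex.I) by ring, mul_left_inj' h2]
  exact_mod_cast Iff.rfl

theorem norm_exp_phase (a t : ℝ) : ‖Complex.exp (2 * Real.pi * a * t * Complex.I)‖ = 1 := by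
  rw [show 2 * (Real.pi : ℂ) * a * t * Complex.I =
    ((2 * Real.pi * a * t : ℝ) : ℂ) * Complex.I by push_cast; ring]
  exact Complex.norm_exp_ofReal_mul_I _

/-- An integer relation between two of the `α_n` is a rational one. Linear independence enters the
proof only through this lemma, hence only pairwise. -/
theorem eq_zero_of_int_mul_eq {α : ℤ → ℝ} (hα : LinearIndependent ℚ α) {m n : ℤ} (hmn : m ≠ n)
    {k l : ℤ} (h : k * α n = l * α m) : k = 0 ∧ l = 0 := by
  have hinj : Function.Injective ![m, n] := by
    intro i j hij
    fin_cases i <;> fin_cases j <;> simp_all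
  have h1 : LinearIndependent ℚ ![α m, α n] := by
    convert hα.comp _ hinj using 1
    funext i
    fin_cases i <;> rfl
  have h2 := LinearIndependent.pair_iff.1 h1 (-l) k (by
    rw [Rat.smul_def, Rat.smul_def]
    push_cast
    linarith)
  constructor
  · exact_mod_cast h2.2
  · have := h2.1
    rw [neg_eq_zero] at this
    exact_mod_cast this

/-- A smooth local choice of the time along the orbits, adapted to one nonzero coordinate. -/
theorem exists_local_phase {α : ℤ → ℝ} {n : ℕ} {p q : Eu n → FourierSpace} (hp : IsPlot p)
    (hq : IsPlot q) {r : Eu n} (h : ∀ᶠ y in 𝓝 r, ∃ t, solenoid α t • p y = q y) {m : ℤ}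
    (hm : α m ≠ 0) (hr : (p r).coeff m ≠ 0) {t : ℝ} (ht : solenoid α t • p r = q r) :
    ∃ s : Eu n → ℝ, ContDiffAt ℝ 1 s r ∧ s r = t ∧ ∀ᶠ y in 𝓝 r,
      (q y).coeff m = Complex.exp (2 * Real.pi * α m * s y * Complex.I) * (p y).coeff m := by
  have hpc : ContDiff ℝ ∞ fun y => (p y).coeff m := (isRapidFamily_coeff hp).1 m
  have hqc : ContDiff ℝ ∞ fun y => (q y).coeff m := (isRapidFamily_coeff hq).1 m
  set e := Complex.exp (2 * Real.pi * α m * t * Complex.I) with he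
  have he0 : e ≠ 0 := Complex.exp_ne_zero _
  -- The phase ratio of the `m`-th coordinates, normalized to be `1` at `r`: the principal logarithm
  -- is then smooth near `g r`. Near `r` the ratio has modulus `1` because the action preserves
  -- moduli, so the imaginary part of its logarithm recovers it.
  let g : Eu n → ℂ := fun y => (q y).coeff m * ((p y).coeff m)⁻¹ / e
  have hg : ContDiffAt ℝ ∞ g r := (hqc.contDiffAt.mul (hpc.contDiffAt.inv hr)).div_const e
  have hgr : g r = 1 := by
    simp only [g, ← ht, solenoid_smul_coeff, ← he]
    field_simp
  refine ⟨fun y => t + (Complex.log (g y)).im / (2 * Real.pi * α m), ?_, ?_, ?_⟩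
  · have h1 : ContDiffAt ℝ ∞ (fun y => Complex.log (g y)) r := by
      have h2 : ContDiffAt ℂ ∞ Complex.log (g r) := Complex.contDiffAt_log (by simp [hgr])
      exact (h2.restrict_scalars ℝ).comp r hg
    have h3 : ContDiffAt ℝ ∞ (fun y => (Complex.log (g y)).im) r :=
      Complex.imCLM.contDiff.contDiffAt.comp r h1
    exact (contDiffAt_const.add (h3.div_const _)).of_le (by simp)
  · simp [hgr]
  · filter_upwards [h, hpc.continuous.continuousAt.eventually_ne hr] with y ⟨t', ht'⟩ hy
    have hn : ‖g y‖ = 1 := by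
      simp only [g, norm_div, norm_mul, norm_inv, ← ht', norm_solenoid_smul_coeff]
      rw [he, norm_exp_phase, div_one, mul_inv_cancel₀ (norm_ne_zero_iff.2 hy)]
    have hexp : Complex.exp ((Complex.log (g y)).im * Complex.I) = g y := by
      have := Complex.norm_mul_exp_arg_mul_I (g y)
      rwa [hn, Complex.ofReal_one, one_mul, ← Complex.log_im] at this
    have hm' : (α m : ℂ) ≠ 0 := by exact_mod_cast hm
    have hpi : (Real.pi : ℂ) ≠ 0 := by exact_mod_cast Real.pi_ne_zero
    have : (2 * Real.pi * α m * ((t + (Complex.log (g y)).im / (2 * Real.pi * α m) : ℝ) : ℂ) *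
        Complex.I : ℂ) = 2 * Real.pi * α m * t * Complex.I +
          (Complex.log (g y)).im * Complex.I := by
      push_cast
      field_simp
    rw [this, Complex.exp_add, ← he, hexp]
    simp only [g]
    field_simp

/-- Where one coordinate is nonzero and the others vanish locally, the time along the orbits has a
smooth local choice. -/
theorem exists_phase_of_single {α : ℤ → ℝ} (hpos : ∀ n, 0 < α n) {n : ℕ}
    {p q : Eu n → FourierSpace} (hp : IsPlot p) (hq : IsPlot q) {r : Eu n}
    (h : ∀ᶠ y in 𝓝 r, ∃ t, solenoid α t • p y = q y) {m : ℤ} (hm : (p r).coeff m ≠ 0)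
    (h0 : ∀ᶠ y in 𝓝 r, ∀ j, j ≠ m → (p y).coeff j = 0) :
    ∃ s : Eu n → ℝ, DifferentiableAt ℝ s r ∧ ∀ᶠ y in 𝓝 r, solenoid α (s y) • p y = q y := by
  obtain ⟨t, ht⟩ := h.self_of_nhds
  obtain ⟨s, hs, -, hsm⟩ := exists_local_phase hp hq h (hpos m).ne' hm ht
  refine ⟨s, hs.differentiableAt (by simp), ?_⟩
  filter_upwards [hsm, h0, h] with y h1 h2 ⟨t', ht'⟩
  ext j
  rw [solenoid_smul_coeff]
  rcases eq_or_ne j m with rfl | hj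
  · exact h1.symm
  · rw [← ht', solenoid_smul_coeff, h2 j hj, mul_zero, mul_zero]

/-- Where two coordinates are nonzero, the time along the orbits has a smooth local choice. -/
theorem exists_phase_of_pair {α : ℤ → ℝ} (hα : LinearIndependent ℚ α) (hpos : ∀ n, 0 < α n)
    {n : ℕ} {p q : Eu n → FourierSpace} (hp : IsPlot p) (hq : IsPlot q) {r : Eu n}
    (h : ∀ᶠ y in 𝓝 r, ∃ t, solenoid α t • p y = q y) {m j : ℤ} (hmj : m ≠ j)
    (hm : (p r).coeff m ≠ 0) (hj : (p r).coeff j ≠ 0) :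
    ∃ s : Eu n → ℝ, DifferentiableAt ℝ s r ∧ ∀ᶠ y in 𝓝 r, solenoid α (s y) • p y = q y := by
  obtain ⟨t, ht⟩ := h.self_of_nhds
  obtain ⟨s, hs, hsr, hsm⟩ := exists_local_phase hp hq h (hpos m).ne' hm ht
  obtain ⟨s', hs', hsr', hsj⟩ := exists_local_phase hp hq h (hpos j).ne' hj ht
  refine ⟨s, hs.differentiableAt (by simp), ?_⟩
  have hpc := (isRapidFamily_coeff hp).1
  -- Each coordinate determines the true time `t` at `y` only modulo its own period: `s y` differs
  -- from it by `k / α m`, and `s' y` by `l / α j`.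
  have hev : ∀ᶠ y in 𝓝 r, ContinuousAt (fun y => s y - s' y) y ∧ ∃ (t : ℝ) (k l : ℤ),
      solenoid α t • p y = q y ∧ α m * s y = α m * t + k ∧ α j * s' y = α j * t + l := by
    filter_upwards [hs.eventually (by simp), hs'.eventually (by simp), hsm, hsj, h,
      (hpc m).continuous.continuousAt.eventually_ne hm,
      (hpc j).continuous.continuousAt.eventually_ne hj] with y h1 h2 h3 h4 ⟨t', ht'⟩ h5 h6
    rw [← ht', solenoid_smul_coeff, mul_left_inj' h5, eq_comm, exp_phase_eq_iff] at h3
    rw [← ht', solenoid_smul_coeff, mul_left_inj' h6, eq_comm, exp_phase_eq_iff] at h4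
    obtain ⟨k, hk⟩ := h3
    obtain ⟨l, hl⟩ := h4
    exact ⟨h1.continuousAt.sub h2.continuousAt, t', k, l, ht', hk, hl⟩
  obtain ⟨ε, hε, hB⟩ := Metric.eventually_nhds_iff_ball.1 hev
  have hdiff : ∀ y t (k l : ℤ), α m * s y = α m * t + k → α j * s' y = α j * t + l →
      s y - s' y = k / α m - l / α j := fun y t k l h1 h2 => by
    have hm0 := (hpos m).ne'
    have hj0 := (hpos j).ne'
    field_simp
    linear_combination α j * h1 - α m * h2
  -- The continuous function `s - s'` takes countably many values on a ball, so it is constant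
  -- there; at `r` both times equal `t`, so the constant is `0`.
  have hpre : IsPreconnected ((fun y => s y - s' y) '' Metric.ball r ε) :=
    (convex_ball r ε).isPreconnected.image _ fun y hy => (hB y hy).1.continuousWithinAt
  have hcount : ((fun y => s y - s' y) '' Metric.ball r ε).Countable := by
    refine (countable_range fun kl : ℤ × ℤ => (kl.1 / α m - kl.2 / α j : ℝ)).mono ?_
    rintro _ ⟨y, hy, rfl⟩
    obtain ⟨-, t', k, l, -, hk, hl⟩ := hB y hy
    exact ⟨(k, l), (hdiff y t' k l hk hl).symm⟩
  have hsub := hcount.isTotallyDisconnected _ subset_rfl hpre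
  filter_upwards [Metric.ball_mem_nhds r hε] with y hy
  obtain ⟨-, t', k, l, ht', hk, hl⟩ := hB y hy
  have h0 : s y - s' y = 0 := by
    rw [hsub (mem_image_of_mem _ hy) (mem_image_of_mem _ (Metric.mem_ball_self hε)), hsr, hsr',
      sub_self]
  rw [hdiff y t' k l hk hl] at h0
  -- Equality of the two times now reads `k / α m = l / α j`; independence forces `k = 0`, so `s y`
  -- is the true time and moves every coordinate correctly.
  have hkl : (k : ℝ) * α j = l * α m := by
    have hm0 := (hpos m).ne'
    have hj0 := (hpos j).ne'
    field_simp at h0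
    linarith
  obtain ⟨rfl, -⟩ := eq_zero_of_int_mul_eq hα hmj hkl
  rw [Int.cast_zero, add_zero] at hk
  rw [mul_left_cancel₀ (hpos m).ne' hk, ht']

/-! ### Descent of the form on the ellipsoid -/

theorem exists_coeff_ne_zero {α : ℤ → ℝ} {Z : FourierSpace} (hZ : Z ∈ ellipsoid α) :
    ∃ m, Z.coeff m ≠ 0 := by
  by_contra! h
  have h1 : ∑' n, α n * ‖Z.coeff n‖ ^ 2 = 1 := hZ
  simp [h] at h1

/-- The restriction of `ω` to the ellipsoid. -/
noncomputable def ellipsoidForm (α : ℤ → ℝ) : DiffForm (ellipsoid α) 2 :=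
  omega.pullback (Subtype.val : ellipsoid α → FourierSpace) (dSmooth_val (ellipsoid α))

theorem isClosed_ellipsoidForm (α : ℤ → ℝ) : (ellipsoidForm α).IsClosed :=
  isClosed_omega.pullback _ _

theorem isBasic_ellipsoidForm {α : ℤ → ℝ} (hα : LinearIndependent ℚ α) (hpos : ∀ n, 0 < α n)
    (hlt : ∀ n, α n < 1) : (ellipsoidForm α).IsBasic (orbitSetoid α) := by
  intro n P Q hP hQ r h
  have hα1 : ∀ m, |α m| ≤ 1 := fun m => by
    rw [abs_of_pos (hpos m)]
    exact (hlt m).le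
  let p : Eu n → FourierSpace := fun y => P y
  let q : Eu n → FourierSpace := fun y => Q y
  have hp : IsPlot p := hP
  have hq : IsPlot q := hQ
  have h' : ∀ᶠ y in 𝓝 r, ∃ t, solenoid α t • p y = q y := h
  have hmem : ∀ y, ∀ᶠ z in 𝓝 y, p z ∈ ellipsoid α := fun y => .of_forall fun z => (P z).2
  change omega.eval p hp r = omega.eval q hq r
  have hpc := (isRapidFamily_coeff hp).1
  -- Either `r` is in the closure of the points with two nonzero coordinates, where the time is
  -- smooth, or near `r` the plot has at most one nonzero coordinate.
  by_cases hfreq : ∃ᶠ y in 𝓝 r, ∃ m j, m ≠ j ∧ (p y).coeff m ≠ 0 ∧ (p y).coeff j ≠ 0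
  · by_contra hne
    have hcont := (omega.contDiff_eval p hp).continuous.continuousAt (x := r)
    have hcont' := (omega.contDiff_eval q hq).continuous.continuousAt (x := r)
    -- By continuity a disagreement at `r` would persist nearby, hence at some point with two
    -- nonzero coordinates, where the forms agree.
    have hne' : ∀ᶠ y in 𝓝 r, omega.eval p hp y ≠ omega.eval q hq y :=
      (hcont.ne_iff_eventually_ne hcont').1 hne
    obtain ⟨y, ⟨m, j, hmj, hm, hj⟩, hy, hy'⟩ := (hfreq.and_eventually
      (hne'.and h'.eventually_nhds)).exists
    obtain ⟨s, hs, hs'⟩ := exists_phase_of_pair hα hpos hp hq hy' hmj hm hj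
    exact hy (omega_eval_eq_of_smooth_phase hα1 hp hq (hmem y) hs hs')
  · obtain ⟨m, hm⟩ := exists_coeff_ne_zero (P r).2
    -- The coordinate `m` is nonzero at `r` and stays so nearby, hence it is the only nonzero one.
    have h0 : ∀ᶠ y in 𝓝 r, ∀ j, j ≠ m → (p y).coeff j = 0 := by
      filter_upwards [not_frequently.1 hfreq, (hpc m).continuous.continuousAt.eventually_ne hm]
        with y h1 h2 j hj
      by_contra h3
      exact h1 ⟨j, m, hj, h3, h2⟩
    obtain ⟨s, hs, hs'⟩ := exists_phase_of_single hpos hp hq h' hm h0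
    exact omega_eval_eq_of_smooth_phase hα1 hp hq (hmem r) hs hs'

/-! ### Singular circles and stabilizers -/

theorem mem_singularCircle_iff {α : ℤ → ℝ} {n : ℤ} {Z : FourierSpace} :
    Z ∈ singularCircle α n ↔ α n * ‖Z.coeff n‖ ^ 2 = 1 ∧ ∀ m, m ≠ n → Z.coeff m = 0 := by
  refine and_congr_left fun h => ?_
  change ∑' m, α m * ‖Z.coeff m‖ ^ 2 = 1 ↔ _
  rw [tsum_eq_single n fun m hm => by simp [h m hm]]

theorem norm_eq_iff_mul_sq_eq_one {a : ℝ} (ha : 0 < a) (z : ℂ) :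
    a * ‖z‖ ^ 2 = 1 ↔ ‖z‖ = 1 / √a := by
  have h : (‖z‖ * √a) ^ 2 = a * ‖z‖ ^ 2 := by
    rw [mul_pow, Real.sq_sqrt ha.le, mul_comm]
  rw [eq_div_iff (Real.sqrt_pos.2 ha).ne', ← h,
    pow_eq_one_iff_of_nonneg (by positivity) two_ne_zero]

theorem coeff_ne_zero_of_mem_singularCircle {α : ℤ → ℝ} {n : ℤ} {Z : FourierSpace}
    (hZ : Z ∈ singularCircle α n) : Z.coeff n ≠ 0 := by
  intro h
  have h1 := (mem_singularCircle_iff.1 hZ).1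
  simp [h] at h1

/-- A coordinate is fixed at time `t` iff it vanishes or `t` is a multiple of its period. -/
theorem exp_phase_mul_eq_self_iff (a t : ℝ) {z : ℂ} (hz : z ≠ 0) :
    Complex.exp (2 * Real.pi * a * t * Complex.I) * z = z ↔ ∃ k : ℤ, a * t = k := by
  have h := exp_phase_eq_iff a t 0
  simp only [Complex.ofReal_zero, mul_zero, zero_mul, Complex.exp_zero, zero_add] at h
  rw [← h, mul_eq_right₀ hz]

theorem stabilizer_singularCircle {α : ℤ → ℝ} (hpos : ∀ n, 0 < α n) {n : ℤ} {Z : FourierSpace}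
    (hZ : Z ∈ singularCircle α n) (t : ℝ) :
    solenoid α t • Z = Z ↔ ∃ k : ℤ, t = k / α n := by
  have hn := (hpos n).ne'
  have h1 : (∃ k : ℤ, t = k / α n) ↔ ∃ k : ℤ, α n * t = k :=
    exists_congr fun k => by rw [eq_div_iff hn, mul_comm]
  rw [h1, ← exp_phase_mul_eq_self_iff _ _ (coeff_ne_zero_of_mem_singularCircle hZ),
    ← solenoid_smul_coeff]
  refine ⟨fun h => by rw [h], fun h => ?_⟩
  ext m
  rcases eq_or_ne m n with rfl | hm
  · exact h
  · rw [solenoid_smul_coeff, hZ.2 m hm, mul_zero]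

theorem range_solenoid_smul_eq {α : ℤ → ℝ} (hpos : ∀ n, 0 < α n) {n : ℤ} {Z : FourierSpace}
    (hZ : Z ∈ singularCircle α n) :
    range (fun t : ℝ => solenoid α t • Z) = singularCircle α n := by
  have hZ' := mem_singularCircle_iff.1 hZ
  ext Y
  constructor
  · rintro ⟨t, rfl⟩
    refine mem_singularCircle_iff.2 ⟨?_, fun m hm => ?_⟩
    · rw [norm_solenoid_smul_coeff]
      exact hZ'.1
    · rw [solenoid_smul_coeff, hZ.2 m hm, mul_zero]
  · intro hY
    have hY' := mem_singularCircle_iff.1 hY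
    have hZ0 := coeff_ne_zero_of_mem_singularCircle hZ
    have hn : ‖Y.coeff n / Z.coeff n‖ = 1 := by
      rw [norm_div, (norm_eq_iff_mul_sq_eq_one (hpos n) _).1 hY'.1,
        ← (norm_eq_iff_mul_sq_eq_one (hpos n) _).1 hZ'.1, div_self (norm_ne_zero_iff.2 hZ0)]
    have hexp := Complex.norm_mul_exp_arg_mul_I (Y.coeff n / Z.coeff n)
    rw [hn, Complex.ofReal_one, one_mul] at hexp
    -- The `n`-th coordinate turns at angular speed `2π α_n`, so this is a time at which it has
    -- turned by the angle from `Z_n` to `Y_n`.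
    refine ⟨(Y.coeff n / Z.coeff n).arg / (2 * Real.pi * α n), ?_⟩
    ext m
    change (solenoid α _ • Z).coeff m = _
    rw [solenoid_smul_coeff]
    rcases eq_or_ne m n with rfl | hm
    · have hm' : (α m : ℂ) ≠ 0 := by exact_mod_cast (hpos m).ne'
      have hpi : (Real.pi : ℂ) ≠ 0 := by exact_mod_cast Real.pi_ne_zero
      have : (2 * Real.pi * α m * (((Y.coeff m / Z.coeff m).arg / (2 * Real.pi * α m) : ℝ) : ℂ) *
          Complex.I : ℂ) = (Y.coeff m / Z.coeff m).arg * Complex.I := by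
        push_cast
        field_simp
      rw [this, hexp, div_mul_cancel₀ _ hZ0]
    · rw [hZ.2 m hm, hY.2 m hm, mul_zero]

/-- The family with a single nonzero coefficient. -/
noncomputable def singleCoeff (n : ℤ) (z : ℂ) : FourierSpace where
  coeff := Pi.single n z
  rapid q := by
    refine tendsto_const_nhds.congr' ?_
    filter_upwards [(finite_singleton n).compl_mem_cofinite] with m hm
    rw [Pi.single_eq_of_ne (by simpa using hm), norm_zero, mul_zero]

/-- Only the index `n` contributes, so the bound uniform in `m` reduces to local boundedness of each
derivative of `f`. This gives smoothness of the inverse of the coordinate map on a singular circle.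
-/
theorem isPlot_singleCoeff {d : ℕ} (n : ℤ) {f : Eu d → ℂ} (hf : ContDiff ℝ ∞ f) :
    IsPlot fun r => singleCoeff n (f r) := by
  have h0 : ∀ m, m ≠ n → (fun r => (singleCoeff n (f r)).coeff m) = fun _ => 0 :=
    fun m hm => funext fun r => Pi.single_eq_of_ne hm _
  have hn : (fun r => (singleCoeff n (f r)).coeff n) = f := funext fun r => Pi.single_eq_same _ _
  change IsRapidFamily fun m r => (singleCoeff n (f r)).coeff m
  refine isRapidFamily_iff.2 ⟨fun m => ?_, fun k q r => ?_⟩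
  · rcases eq_or_ne m n with rfl | hm
    · rwa [hn]
    · rw [h0 m hm]
      exact contDiff_const
  · have hc : Continuous fun s => (1 + |(n : ℝ)|) ^ q * ‖iteratedFDeriv ℝ k f s‖ :=
      continuous_const.mul (hf.continuous_iteratedFDeriv (by exact_mod_cast le_top)).norm
    refine ⟨(1 + |(n : ℝ)|) ^ q * ‖iteratedFDeriv ℝ k f r‖ + 1, ?_⟩
    filter_upwards [hc.continuousAt.eventually_lt continuousAt_const (lt_add_one _)] with s hs m
    rcases eq_or_ne m n with rfl | hm
    · rw [hn]
      exact hs.le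
    · rw [h0 m hm]
      have : iteratedFDeriv ℝ k (fun _ : Eu d => (0 : ℂ)) s = 0 := by
        rw [iteratedFDeriv_fun_zero]
        rfl
      rw [this, norm_zero, mul_zero]
      positivity

/-- The `n`-th coordinate identifies the `n`-th singular circle with a circle in `ℂ`. -/
noncomputable def singularCircleEquiv {α : ℤ → ℝ} (hpos : ∀ n, 0 < α n) (n : ℤ) :
    singularCircle α n ≃ Metric.sphere (0 : ℂ) (1 / √(α n)) where
  toFun Z := ⟨Z.1.coeff n, by
    rw [mem_sphere_zero_iff_norm, ← norm_eq_iff_mul_sq_eq_one (hpos n)]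
    exact (mem_singularCircle_iff.1 Z.2).1⟩
  invFun z := ⟨singleCoeff n z, mem_singularCircle_iff.2 ⟨by
    have h : (singleCoeff n z).coeff n = z := Pi.single_eq_same _ _
    rw [h, norm_eq_iff_mul_sq_eq_one (hpos n)]
    exact mem_sphere_zero_iff_norm.1 z.2, fun m hm => Pi.single_eq_of_ne hm _⟩⟩
  left_inv Z := by
    ext m
    rcases eq_or_ne m n with rfl | hm
    · exact Pi.single_eq_same _ _
    · exact (Pi.single_eq_of_ne hm _).trans (Z.2.2 m hm).symm
  right_inv z := Subtype.ext (Pi.single_eq_same _ _)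

theorem isPlot_complex_iff {d : ℕ} {f : Eu d → ℂ} : IsPlot f ↔ ContDiff ℝ ∞ f := Iff.rfl

theorem dSmooth_singularCircleEquiv {α : ℤ → ℝ} (hpos : ∀ n, 0 < α n) (n : ℤ) :
    DSmooth (singularCircleEquiv hpos n) := fun _ p hp =>
  isPlot_complex_iff.2 ((isRapidFamily_coeff (p := Subtype.val ∘ p) hp).1 n)

theorem dSmooth_singularCircleEquiv_symm {α : ℤ → ℝ} (hpos : ∀ n, 0 < α n) (n : ℤ) :
    DSmooth (singularCircleEquiv hpos n).symm := fun _ _ hp =>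
  isPlot_singleCoeff n (isPlot_complex_iff.1 hp)

theorem disjoint_singularCircle (α : ℤ → ℝ) {m n : ℤ} (hmn : m ≠ n) :
    Disjoint (singularCircle α m) (singularCircle α n) :=
  disjoint_left.2 fun _ hm hn => coeff_ne_zero_of_mem_singularCircle hm (hn.2 m hmn)

/-- Off the singular circles two coordinates are nonzero, so `α m * t = k` and `α n * t = l` are
both integers. Eliminating `t` gives `k * α n = l * α m`, which forces `k = 0`. -/
theorem eq_zero_of_solenoid_smul_eq {α : ℤ → ℝ} (hα : LinearIndependent ℚ α)
    (hpos : ∀ n, 0 < α n) {Z : FourierSpace} (hZ : Z ∈ ellipsoid α)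
    (hs : ∀ n, Z ∉ singularCircle α n) {t : ℝ} (ht : solenoid α t • Z = Z) : t = 0 := by
  obtain ⟨n, hn⟩ := exists_coeff_ne_zero hZ
  obtain ⟨m, hmn, hm⟩ : ∃ m, m ≠ n ∧ Z.coeff m ≠ 0 := by
    by_contra! h
    exact hs n ⟨hZ, h⟩
  have h : ∀ j, Z.coeff j ≠ 0 → ∃ k : ℤ, α j * t = k := fun j hj => by
    rw [← exp_phase_mul_eq_self_iff _ _ hj, ← solenoid_smul_coeff, ht]
  obtain ⟨k, hk⟩ := h m hm
  obtain ⟨l, hl⟩ := h n hn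
  obtain ⟨rfl, -⟩ := eq_zero_of_int_mul_eq hα hmn (k := k) (l := l) (by rw [← hk, ← hl]; ring)
  simpa [(hpos m).ne'] using hk

end EllipsoidReduction

open EllipsoidReduction Diffeology

theorem mainTheorem3 (α : ℤ → ℝ) (hα : LinearIndependent ℚ α)
    (hpos : ∀ n, 0 < α n) (hlt : ∀ n, α n < 1) :
    -- each singular circle is one orbit, with stabilizer `(1 / α n) ℤ`
    ((∀ n, ∀ Z ∈ singularCircle α n,
        Set.range (fun t : ℝ => solenoid α t • Z) = singularCircle α n ∧
        ∀ t : ℝ, solenoid α t • Z = Z ↔ ∃ k : ℤ, t = k / α n) ∧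
      -- it is diffeomorphic to the circle of radius `1 / √(α n)`
      (∀ n, ∃ e : singularCircle α n ≃ Metric.sphere (0 : ℂ) (1 / √(α n)),
        (∀ Z, (e Z : ℂ) = Z.1.coeff n) ∧ DSmooth e ∧ DSmooth e.symm) ∧
      -- these circles are pairwise disjoint, and the action is free outside them
      (∀ m n, m ≠ n → Disjoint (singularCircle α m) (singularCircle α n)) ∧
      (∀ Z ∈ ellipsoid α, (∀ n, Z ∉ singularCircle α n) →
        ∀ t : ℝ, solenoid α t • Z = Z → t = 0)) ∧
    -- the restriction of the closed form `omega` descends to a closed form on the quotient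
    omega.IsClosed ∧
    ∃ β : DiffForm (QuasiProjective α) 2, β.IsClosed ∧
      β.pullback (Quotient.mk (orbitSetoid α)) (dSmooth_mk (orbitSetoid α)) =
        omega.pullback (Subtype.val : ellipsoid α → FourierSpace) (dSmooth_val (ellipsoid α)) := by
  refine ⟨⟨fun n Z hZ => ⟨range_solenoid_smul_eq hpos hZ, stabilizer_singularCircle hpos hZ⟩,
    fun n => ⟨singularCircleEquiv hpos n, fun _ => rfl, dSmooth_singularCircleEquiv hpos n,
      dSmooth_singularCircleEquiv_symm hpos n⟩,
    fun m n hmn => disjoint_singularCircle α hmn,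
    fun Z hZ hs t ht => eq_zero_of_solenoid_smul_eq hα hpos hZ hs ht⟩,
    isClosed_omega, ?_⟩
  have hb := isBasic_ellipsoidForm hα hpos hlt
  exact ⟨DiffForm.descend hb, DiffForm.isClosed_descend hb (isClosed_ellipsoidForm α),
    DiffForm.pullback_descend hb⟩
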